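/- **Setting.** Let $n\ge 1$, let $\mathcal G_1,\dots,\mathcal G_\nu$ be finitely many connected undirected graphs on $\{1,\dots,n\}$ (communication topologies) with Laplacians $\mathcal L_\ell$, let $A,D,\mathcal K\in\mathbb R^{n\times n}$ be diagonal with positive diagonal entries, and let $h\ge 0$. The directed links of each $\mathcal G_\ell$ are assigned to finitely many channels $m=1,\dots,N$, and $T_{\ell,m}$ is the sum, over the links $k\to i$ of $\mathcal G_\ell$ on channel $m$, of the matrix with entries $1$ at $(i,i)$ and $-1$ at $(i,k)$ and zeros elsewhere, so that $\sum_m T_{\ell,m}=\mathcal L_\ell$ (one link per channel is the standard case; $N=1$ gives $T_{\ell,1}=\mathcal L_\ell$). For $\kappa>0$ put $K=\kappa\mathcal K$, $\mu=\|K^{-1/2}A^{-1}\mathbf 1\|_2^2$, and let $W\in\mathbb R^{n\times(n-1)}$ have orthonormal columns, all orthogonal to $K^{-1/2}A^{-1}\mathbf 1$. Put $$\mathcal T_{\ell,m}=W^\top K^{1/2}A\,T_{\ell,m}AK^{1/2}W,\qquad \bar{\mathcal L}_\ell=W^\top K^{1/2}A\,\mathcal L_\ell AK^{1/2}W .$$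 **LMI conditions.** For $(n-1)\times(n-1)$ matrices $R_m>0$, $S_m>0$ and $S_{12,m}$ let $R,S,S_{12}$ be the block-diagonal matrices formed from them, and $\bar R=h^2\sum_m R_m$. The conditions are, for every $\ell$, $$\Psi_\ell=\begin{bmatrix}\Psi_{11}&\Psi_{12}&0&\Psi_{14}\\ *&\Psi_{22}&\Psi_{23}&\Psi_{24}\\ *&*&R+S&S_{12}+S\\ *&*&*&R+S+\Psi_{44}\end{bmatrix}>0,\qquad \begin{bmatrix}R&S_{12}\\ *&R\end{bmatrix}\ge 0,$$ where $\Psi_{11}=D-K^{1/2}W\bar RW^\top K^{1/2}$, $\Psi_{12}=K^{1/2}W\bar R\bar{\mathcal L}_\ell$, $\Psi_{22}=\bar{\mathcal L}_\ell-\bar{\mathcal L}_\ell\bar R\bar{\mathcal L}_\ell$, $\Psi_{23}=-[S_1\,\cdots\,S_N]$, $\Psi_{14}$ is the block row with blocks $-K^{1/2}W\bar R\mathcal T_{\ell,m}$, $\Psi_{24}$ is the block row with blocks $\bar{\mathcal L}_\ell\bar R\mathcal T_{\ell,m}-S_m-\tfrac12\mathcal T_{\ell,m}$, and $\Psi_{44}$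 is block diagonal with blocks $-\mathcal T_{\ell,m}^\top\bar R\mathcal T_{\ell,m}$. **System.** Consider a power network with inertias $M_i>0$ ($M=\operatorname{diag}(M_i)$), voltages $V_i>0$, symmetric susceptances $B_{ik}\le 0$ $(i\ne k)$ whose graph is connected, net injections $P^{\rm net}\in\mathbb R^n$, nominal frequency $\omega^d>0$, and potential $U(\theta)=-\sum_{\{i,k\}}|B_{ik}|V_iV_k\cos(\theta_i-\theta_k)$. Assume that the closed loop $$\dot\theta=\omega,\quad M\dot\omega=-D(\omega-\omega^d\mathbf 1)+P^{\rm net}-\nabla U(\theta)-p,\quad \dot p=K(\omega-\omega^d\mathbf 1)-KA\sum_m T_{\sigma(t),m}A\,p(t-\tau_m(t))$$ has a synchronized motion, i.e. a solution $\theta^*(t)=\theta_0^*+\omega^s\mathbf 1t$, $\omega=\omega^s\mathbf 1$, $p=p^*$ constant, for every active topology, with $|\theta^*_{0,i}-\theta^*_{0,k}|<\pi/2$ whenever $B_{ik}\ne0$. In reduced error coordinates $z=(\tilde\theta,\tilde\omega,\tilde p)\in\mathbb R^{3n-1}$ it reads $$\dot{\tilde\theta}=\tilde\omega,\quad M\dot{\tilde\omega}=-D\tilde\omega-\nabla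 U(\tilde\theta+\theta^*)+\nabla U(\theta^*)-K^{1/2}W\tilde p-\tfrac1\mu A^{-1}\mathbf 1\mathbf 1^\top A^{-1}\tilde\theta,$$ $$\dot{\tilde p}=W^\top K^{1/2}\tilde\omega-\sum_m\mathcal T_{\sigma(t),m}\,\tilde p(t-\tau_m(t)).$$ **Claim.** Let $R_m$ and $S_{12,m}$ be given such that $\begin{bmatrix}R&S_{12}\\ *&R\end{bmatrix}>0$. Then there is $\kappa_0>0$, depending only on $h,A,D,\mathcal K$, the topologies, the channel assignment, $R$ and $S_{12}$, such that for all $0<\kappa<\kappa_0$, $K=\kappa\mathcal K$, and every $W$ as above: 1. there are $S_m>0$ which, with the given $R_m,S_{12,m}$, satisfy the LMI conditions simultaneously for all $\ell$; 2. for every power network and synchronized motion as above, $z^*=0$ is a locally uniformly asymptotically stable equilibrium of the reduced error system for all uniform fast-varying delays $\tau_m(t)=\tau(t)\in[0,h]$ ($\tau$ measurable) and all (measurable) switching signals $\sigma:\mathbb R_{\ge0}\to\{1,\dots,\nu\}$. Here the stability and attraction bounds are uniform in the initial time $t_0\ge0$, in $\tau$ and in $\sigma$. -/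

import Mathlib

open Matrix

noncomputable section

open scoped Classical in
/-- The Laplacian matrix `L = (degrees) - (adjacency)` of an undirected graph. -/
def DAI.laplacian {n : ℕ} (G : SimpleGraph (Fin n)) : Matrix (Fin n) (Fin n) ℝ :=
  G.lapMatrix ℝ

open scoped Classical in
/-- Contribution of the delay channel `c` to the Laplacian of the communication graph `G`.
The directed link `k → i` of an edge `{i, k}` is transmitted over the channel `ch i k` and
contributes the matrix whose only nonzero entries are `1` at `(i, i)` and `-1` at `(i, k)`.
If `ch` is injective on the directed links, every channel carries one link (and is zero when
it is not used by `G`); if `ch` is not injective, links that share a channel share its delay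
and their matrices add up. In all cases the sum over `c` is the Laplacian. -/
def DAI.channelMatrix {n : ℕ} {C : Type*} (G : SimpleGraph (Fin n))
    (ch : Fin n → Fin n → C) (c : C) : Matrix (Fin n) (Fin n) ℝ :=
  ∑ i, ∑ k, if G.Adj i k ∧ ch i k = c then
    Matrix.single i i (1 : ℝ) - Matrix.single i k (1 : ℝ) else 0

/-- `K^{1/2}` for the diagonal matrix `K = diag(K_i)`. -/
def DAI.sqrtGain {n : ℕ} (K : Fin n → ℝ) : Matrix (Fin n) (Fin n) ℝ :=
  Matrix.diagonal fun i => Real.sqrt (K i)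

/-- The vector `K^{-1/2} A^{-1} 1`. -/
def DAI.kernelVec {n : ℕ} (K A : Fin n → ℝ) : Fin n → ℝ :=
  fun i => (Real.sqrt (K i))⁻¹ * (A i)⁻¹

/-- `μ = ‖K^{-1/2} A^{-1} 1‖₂²`. -/
def DAI.mu {n : ℕ} (K A : Fin n → ℝ) : ℝ :=
  DAI.kernelVec K A ⬝ᵥ DAI.kernelVec K A

/-- `W ∈ ℝ^{n × (n-1)}` has orthonormal columns, all orthogonal to `K^{-1/2} A^{-1} 1`. -/
def DAI.IsReduction {n : ℕ} (K A : Fin n → ℝ) (W : Matrix (Fin n) (Fin (n - 1)) ℝ) : Prop :=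
  Wᵀ * W = 1 ∧ Wᵀ *ᵥ DAI.kernelVec K A = 0

/-- `Wᵀ K^{1/2} A X A K^{1/2} W`. With `X` the Laplacian this is the reduced Laplacian, and with
`X` a channel matrix it is the reduced channel matrix. -/
def DAI.reduced {n : ℕ} (K A : Fin n → ℝ) (W : Matrix (Fin n) (Fin (n - 1)) ℝ)
    (X : Matrix (Fin n) (Fin n) ℝ) : Matrix (Fin (n - 1)) (Fin (n - 1)) ℝ :=
  Wᵀ * DAI.sqrtGain K * Matrix.diagonal A * X * Matrix.diagonal A * DAI.sqrtGain K * W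

/-- The block row `[X_1 ... X_c ...]`. -/
def DAI.blockRow {C m k : Type*} (X : C → Matrix m k ℝ) : Matrix m (k × C) ℝ :=
  Matrix.of fun i j => X j.2 i j.1

/-- The block matrix `[R, S12; *, R]` with `R = blockdiag(R_c)`, `S12 = blockdiag(S12_c)`. -/
def DAI.couplingMatrix {n : ℕ} {C : Type*} [DecidableEq C]
    (R S12 : C → Matrix (Fin (n - 1)) (Fin (n - 1)) ℝ) :
    Matrix ((Fin (n - 1) × C) ⊕ (Fin (n - 1) × C)) ((Fin (n - 1) × C) ⊕ (Fin (n - 1) × C)) ℝ :=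
  Matrix.fromBlocks (Matrix.blockDiagonal R) (Matrix.blockDiagonal S12)
    (Matrix.blockDiagonal S12)ᵀ (Matrix.blockDiagonal R)

/-- The symmetric block matrix `Ψ` of the delay-dependent stability condition, for the
communication graph `G` with channel assignment `ch` and delay bounds `h_c`. -/
def DAI.Psi {n : ℕ} {C : Type*} [Fintype C] [DecidableEq C]
    (D A K : Fin n → ℝ) (W : Matrix (Fin n) (Fin (n - 1)) ℝ)
    (G : SimpleGraph (Fin n)) (ch : Fin n → Fin n → C) (h : C → ℝ)
    (R S S12 : C → Matrix (Fin (n - 1)) (Fin (n - 1)) ℝ) :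
    Matrix ((Fin n ⊕ Fin (n - 1)) ⊕ ((Fin (n - 1) × C) ⊕ (Fin (n - 1) × C)))
      ((Fin n ⊕ Fin (n - 1)) ⊕ ((Fin (n - 1) × C) ⊕ (Fin (n - 1) × C))) ℝ :=
  let KW : Matrix (Fin n) (Fin (n - 1)) ℝ := DAI.sqrtGain K * W
  let Lbar := DAI.reduced K A W (DAI.laplacian G)
  let T : C → Matrix (Fin (n - 1)) (Fin (n - 1)) ℝ :=
    fun c => DAI.reduced K A W (DAI.channelMatrix G ch c)
  let Rbar : Matrix (Fin (n - 1)) (Fin (n - 1)) ℝ := ∑ c, (h c) ^ 2 • R c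
  let Psi11 := Matrix.diagonal D - KW * Rbar * KWᵀ
  let Psi12 := KW * Rbar * Lbar
  let Psi22 := Lbar - Lbar * Rbar * Lbar
  let Psi14 := DAI.blockRow fun c => -(KW * Rbar * T c)
  let Psi23 := -DAI.blockRow S
  let Psi24 := DAI.blockRow fun c => Lbar * Rbar * T c - S c - (1 / 2 : ℝ) • T c
  let Psi33 := Matrix.blockDiagonal R + Matrix.blockDiagonal S
  let Psi34 := Matrix.blockDiagonal S12 + Matrix.blockDiagonal S
  let Psi44 := Matrix.blockDiagonal R + Matrix.blockDiagonal S +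
    Matrix.blockDiagonal fun c => -((T c)ᵀ * Rbar * T c)
  Matrix.fromBlocks
    (Matrix.fromBlocks Psi11 Psi12 Psi12ᵀ Psi22)
    (Matrix.fromBlocks 0 Psi14 Psi23 Psi24)
    (Matrix.fromBlocks 0 Psi14 Psi23 Psi24)ᵀ
    (Matrix.fromBlocks Psi33 Psi34 Psi34ᵀ Psi44)

/-- The matrices `R_c, S_c, S12_c` solve the linear matrix inequalities of the robust stability
condition, simultaneously for all communication graphs `G ℓ`. -/
structure DAI.SolvesLMI {n : ℕ} {ι C : Type*} [Fintype C] [DecidableEq C]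
    (D A K : Fin n → ℝ) (W : Matrix (Fin n) (Fin (n - 1)) ℝ)
    (G : ι → SimpleGraph (Fin n)) (ch : ι → Fin n → Fin n → C) (h : C → ℝ)
    (R S S12 : C → Matrix (Fin (n - 1)) (Fin (n - 1)) ℝ) : Prop where
  R_pos : ∀ c, (R c).PosDef
  S_pos : ∀ c, (S c).PosDef
  Psi_pos : ∀ ℓ, (DAI.Psi D A K W (G ℓ) (ch ℓ) h R S S12).PosDef
  coupling_nonneg : (DAI.couplingMatrix R S12).PosSemidef

/-- The physical data of a Kron-reduced, lossless power network with `n` nodes, apart from the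
damping coefficients: inertias `M_i`, voltage amplitudes `V_i`, susceptances `B_ik` of a connected
electrical network, net power injections `P^net_i = P^d_i - G_ii V_i²`, nominal frequency. -/
structure DAI.PowerNetwork (n : ℕ) where
  M : Fin n → ℝ
  M_pos : ∀ i, 0 < M i
  V : Fin n → ℝ
  V_pos : ∀ i, 0 < V i
  B : Fin n → Fin n → ℝ
  B_symm : ∀ i k, B i k = B k i
  B_nonpos : ∀ i k, i ≠ k → B i k ≤ 0
  connected : (SimpleGraph.fromRel fun i k => B i k ≠ 0).Connected
  Pnet : Fin n → ℝ
  ωd : ℝ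
  ωd_pos : 0 < ωd

/-- The potential `U(θ) = - ∑_{{i,k}} |B_ik| V_i V_k cos (θ_i - θ_k)`; each unordered pair is
listed once, as `i < k`. -/
def DAI.PowerNetwork.potential {n : ℕ} (N : DAI.PowerNetwork n) (θ : Fin n → ℝ) : ℝ :=
  -∑ i, ∑ k, if i < k then |N.B i k| * N.V i * N.V k * Real.cos (θ i - θ k) else 0

/-- The active power flows `P_i(θ) = ∑_k |B_ik| V_i V_k sin (θ_i - θ_k)`, i.e. `∇U(θ)`. -/
def DAI.PowerNetwork.gradU {n : ℕ} (N : DAI.PowerNetwork n) (θ : Fin n → ℝ) : Fin n → ℝ :=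
  fun i => ∑ k, |N.B i k| * N.V i * N.V k * Real.sin (θ i - θ k)

/-- `gradU` is the gradient of the potential. -/
theorem DAI.PowerNetwork.hasDerivAt_potential {n : ℕ} (N : DAI.PowerNetwork n) (θ v : Fin n → ℝ) :
    HasDerivAt (fun s : ℝ => N.potential (θ + s • v)) (N.gradU θ ⬝ᵥ v) 0 := by
  have h : HasDerivAt (fun s : ℝ => N.potential (θ + s • v))
     (-∑ i, ∑ k, if i < k then |N.B i k| * N.V i * N.V k * (-Real.sin (θ i - θ k) * (v i - v k)) else 0) 0 := by
    unfold DAI.PowerNetwork.potential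
    refine HasDerivAt.neg ?_
    refine HasDerivAt.fun_sum fun i _ => HasDerivAt.fun_sum fun k _ => ?_
    split_ifs
    · refine HasDerivAt.const_mul _ ?_
      have h0 : HasDerivAt (fun s : ℝ => (θ + s • v) i - (θ + s • v) k) (v i - v k) 0 := by
        have := ((hasDerivAt_id (0:ℝ)).mul_const (v i - v k)).const_add (θ i - θ k)
        simp only [one_mul, id] at this
        refine this.congr_of_eventuallyEq (Filter.Eventually.of_forall fun s => ?_)
        simp; ring
      simpa using h0.cos
    · exact hasDerivAt_const _ _
  convert h using 1
  set f : Fin n → Fin n → ℝ := fun i k => |N.B i k| * N.V i * N.V k * Real.sin (θ i - θ k) with hf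
  have hanti : ∀ i k, f i k = - f k i := by
    intro i k; simp only [hf]; rw [N.B_symm i k, ← neg_sub (θ k), Real.sin_neg]; ring
  have e1 : N.gradU θ ⬝ᵥ v = ∑ i, ∑ k, f i k * v i := by
    simp [dotProduct, DAI.PowerNetwork.gradU, hf, Finset.sum_mul]
  have e2 : ∀ i k, f i k * v i = (if i < k then f i k * v i else 0) + (if k < i then f i k * v i else 0) := by
    intro i k
    rcases lt_trichotomy i k with h | h | h
    · simp [h, h.le.not_gt]
    · subst h; simp [hf]
    · simp [h, h.le.not_gt]
  rw [e1]
  rw [Finset.sum_congr rfl fun i _ => Finset.sum_congr rfl fun k _ => e2 i k]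
  simp only [Finset.sum_add_distrib]
  rw [Finset.sum_comm (f := fun i k => if k < i then f i k * v i else 0), ← Finset.sum_add_distrib, ← Finset.sum_neg_distrib]
  refine Finset.sum_congr rfl fun i _ => ?_
  rw [← Finset.sum_add_distrib, ← Finset.sum_neg_distrib]
  refine Finset.sum_congr rfl fun k _ => ?_
  split_ifs
  · rw [hanti k i]; simp only [hf]; ring
  · simp

/-- Right-hand side of the closed loop in the original coordinates `(θ, ω, p)`, when the
communication topology is `G`; `pd c` is the delayed value of `p` on channel `c`. -/
def DAI.physicalField {n : ℕ} {C : Type*} [Fintype C] (N : DAI.PowerNetwork n)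
    (D A K : Fin n → ℝ) (G : SimpleGraph (Fin n)) (ch : Fin n → Fin n → C)
    (x : (Fin n → ℝ) × (Fin n → ℝ) × (Fin n → ℝ)) (pd : C → Fin n → ℝ) :
    (Fin n → ℝ) × (Fin n → ℝ) × (Fin n → ℝ) :=
  (x.2.1,
   fun i => (N.M i)⁻¹ *
     (-(D i * (x.2.1 i - N.ωd)) + N.Pnet i - N.gradU x.1 i - x.2.2 i),
   fun i => K i * (x.2.1 i - N.ωd) -
     K i * A i * (∑ c, DAI.channelMatrix G ch c *ᵥ (Matrix.diagonal A *ᵥ pd c)) i)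

/-- `θ(t) = θ₀ + ωs t 1`, `ω = ωs 1`, `p` constant, is a synchronized motion: it solves the closed
loop for all `t ≥ 0`, whichever topology is active, and neighboring angles differ by less than
`π / 2`. (The delays play no role, since `p` is constant.) -/
structure DAI.IsSynchronizedMotion {n : ℕ} {ι C : Type*} [Fintype C] (N : DAI.PowerNetwork n)
    (D A K : Fin n → ℝ) (G : ι → SimpleGraph (Fin n)) (ch : ι → Fin n → Fin n → C)
    (θ₀ : Fin n → ℝ) (ωs : ℝ) (p : Fin n → ℝ) : Prop where
  solves : ∀ ℓ, ∀ t : ℝ, 0 ≤ t →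
    HasDerivAt (fun s : ℝ => ((fun i => θ₀ i + ωs * s, fun _ => ωs, p) :
        (Fin n → ℝ) × (Fin n → ℝ) × (Fin n → ℝ)))
      (DAI.physicalField N D A K (G ℓ) (ch ℓ)
        (fun i => θ₀ i + ωs * t, fun _ => ωs, p) (fun _ => p)) t
  angles : ∀ i k, N.B i k ≠ 0 → |θ₀ i - θ₀ k| < Real.pi / 2

/-- Reduced error states `z = (θ̃, ω̃, p̃) ∈ ℝ^{3n-1}`. -/
abbrev DAI.State (n : ℕ) : Type := (Fin n → ℝ) × (Fin n → ℝ) × (Fin (n - 1) → ℝ)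

/-- Right-hand side of the closed loop in reduced error coordinates, when the communication
topology is `G`; `pd c` is the delayed value of `p̃` on channel `c`. The vector `θs` collects the
angles of the synchronized motion at time `0`: later angles differ from them by a common shift,
which `gradU` does not see. -/
def DAI.errorField {n : ℕ} {C : Type*} [Fintype C] (N : DAI.PowerNetwork n)
    (D A K : Fin n → ℝ) (W : Matrix (Fin n) (Fin (n - 1)) ℝ) (θs : Fin n → ℝ)
    (G : SimpleGraph (Fin n)) (ch : Fin n → Fin n → C)
    (z : DAI.State n) (pd : C → Fin (n - 1) → ℝ) : DAI.State n :=
  (z.2.1,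
   fun i => (N.M i)⁻¹ *
     (-(D i * z.2.1 i) - N.gradU (z.1 + θs) i + N.gradU θs i
       - ((DAI.sqrtGain K * W) *ᵥ z.2.2) i
       - (DAI.mu K A)⁻¹ * (A i)⁻¹ * ∑ k, (A k)⁻¹ * z.1 k),
   (Wᵀ * DAI.sqrtGain K) *ᵥ z.2.1 -
     ∑ c, DAI.reduced K A W (DAI.channelMatrix G ch c) *ᵥ pd c)

/-- `z`, given on `[t₀ - h, t₁]`, is a solution on `[t₀, t₁]` (in the sense of Carathéodory) of the
switched delay system in reduced error coordinates, for the switching signal `σ` and delays `τ_c`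
with values in `[0, h]`. The values on `[t₀ - h, t₀]` are the initial function. -/
def DAI.IsSolution {n : ℕ} {ι C : Type*} [Fintype C] (N : DAI.PowerNetwork n)
    (D A K : Fin n → ℝ) (W : Matrix (Fin n) (Fin (n - 1)) ℝ) (θs : Fin n → ℝ)
    (G : ι → SimpleGraph (Fin n)) (ch : ι → Fin n → Fin n → C) (h : ℝ)
    (σ : ℝ → ι) (τ : C → ℝ → ℝ) (t₀ t₁ : ℝ) (z : ℝ → DAI.State n) : Prop :=
  ContinuousOn z (Set.Icc (t₀ - h) t₁) ∧
  ∀ t ∈ Set.Icc t₀ t₁, z t = z t₀ +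
    ∫ s in t₀..t, DAI.errorField N D A K W θs (G (σ s)) (ch (σ s)) (z s)
      (fun c => (z (s - τ c s)).2.2)

/-- An arbitrary (measurable) switching signal together with a fast-varying delay with values in
`[0, h]`: no continuity or differentiability of the delay is required. -/
structure DAI.Signal (ι : Type*) (h : ℝ) where
  σ : ℝ → ι
  σ_meas : ∀ ℓ, MeasurableSet (σ ⁻¹' {ℓ})
  τ : ℝ → ℝ
  τ_meas : Measurable τ
  τ_mem : ∀ t, τ t ∈ Set.Icc 0 h

/-- Local uniform asymptotic stability of the zero equilibrium for a family of delay systems with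
maximal delay `h`: `Sol j t₀ t₁ z` says that `z` solves system `j` on `[t₀, t₁]`. All bounds are
uniform in the initial time `t₀ ≥ 0` and in the member `j` of the family. Since `t₁` is arbitrary,
the bounds apply to solutions on bounded intervals and to global solutions alike. -/
structure DAI.IsLUAS {J E : Type*} [NormedAddCommGroup E] (h : ℝ)
    (Sol : J → ℝ → ℝ → (ℝ → E) → Prop) : Prop where
  equilibrium : ∀ j t₀ t₁, 0 ≤ t₀ → t₀ ≤ t₁ → Sol j t₀ t₁ fun _ => 0
  stable : ∀ ε > 0, ∃ δ > 0, ∀ j t₀ t₁ z, 0 ≤ t₀ → t₀ ≤ t₁ → Sol j t₀ t₁ z →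
    (∀ s ∈ Set.Icc (t₀ - h) t₀, ‖z s‖ < δ) → ∀ t ∈ Set.Icc t₀ t₁, ‖z t‖ < ε
  attractive : ∃ δ > 0, ∀ ε > 0, ∃ T > (0 : ℝ), ∀ j t₀ t₁ z, 0 ≤ t₀ → t₀ ≤ t₁ → Sol j t₀ t₁ z →
    (∀ s ∈ Set.Icc (t₀ - h) t₀, ‖z s‖ < δ) → ∀ t ∈ Set.Icc (t₀ + T) t₁, ‖z t‖ < ε

end

/-!
Write `s = √κ`. The matrices `K^{1/2} W`, reduced Laplacians and reduced channel matrices have norms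
of order `s`, `s²` and `s²`, uniformly in `W`. Substituting `x₂ ↦ s⁻¹ x₂` in the quadratic form of
`Ψ` shows that, with `S = κ I`, it is the sum of the forms of `D`, of the reduced Laplacian and of
the coupling matrix `[R, S₁₂; S₁₂ᵀ, R]`, up to a perturbation of relative order `s`. The reduced
Laplacians are coercive because the graphs are connected and `W` avoids the kernel direction
`K^{-1/2} A⁻¹ 𝟏`. So all three forms are positive definite and absorb the perturbation for small
`κ`.

For stability, a uniform delay makes the channels add up to a single delayed reduced Laplacian. The
angle condition makes the potential of the error system strongly convex near `0`; its energy with a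
small cross term `θ ⬝ M ω` then decays up to the mismatch between `p` and its delayed value. As the
reduced Laplacian is of order `κ`, a Lyapunov–Krasovskii term of weight `O(κ)` recording the past of
`ṗ` absorbs this mismatch for small `κ`, whatever the switching, and the decay is exponential.
-/

namespace DAI

open MeasureTheory Set Filter Topology
open scoped NNReal Matrix.Norms.L2Operator

section Analysis

variable {E : Type*} [NormedAddCommGroup E] [NormedSpace ℝ E]

theorem lt_of_forall_le_imp_lt {g : ℝ → ℝ} {a b r : ℝ} (hg : ContinuousOn g (Icc a b))
    (ha : g a ≤ r) (htrap : ∀ c ∈ Icc a b, (∀ t ∈ Icc a c, g t ≤ r) → g c < r) :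
    ∀ t ∈ Icc a b, g t < r := by
  by_contra! hexit
  obtain ⟨c, ⟨hc, hrc⟩, hfirst⟩ :=
    (isCompact_Icc.of_isClosed_subset (hg.preimage_isClosed_of_isClosed isClosed_Icc isClosed_Ici)
      inter_subset_left : IsCompact (Icc a b ∩ g ⁻¹' Ici r)).exists_isLeast hexit
  obtain ⟨t, ht, rfl⟩ :=
    intermediate_value_Icc hc.1 (hg.mono (Icc_subset_Icc_right hc.2)) ⟨ha, hrc⟩
  obtain rfl : t = c := le_antisymm ht.2
    (hfirst ⟨⟨ht.1, ht.2.trans hc.2⟩, mem_preimage.2 self_mem_Ici⟩)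
  refine (htrap t hc fun s hs => ?_).false
  by_contra! hlt
  obtain rfl : s = t := le_antisymm hs.2 (hfirst ⟨⟨hs.1, hs.2.trans hc.2⟩, hlt.le⟩)
  exact hlt.false

theorem absolutelyContinuousOnInterval_contDiff_comp {Φ : E → ℝ} (hΦ : ContDiff ℝ 1 Φ)
    {X : ℝ → E} {K : ℝ≥0} {a b : ℝ} (hX : LipschitzOnWith K X (uIcc a b)) :
    AbsolutelyContinuousOnInterval (fun t => Φ (X t)) a b := by
  have hc : IsCompact (X '' uIcc a b) := isCompact_uIcc.image_of_continuousOn hX.continuousOn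
  obtain ⟨C, hC⟩ := (hΦ.locallyLipschitz.locallyLipschitzOn (s := X '' uIcc a b))
    |>.exists_lipschitzOnWith_of_compact hc
  exact (hC.comp hX (mapsTo_image _ _)).absolutelyContinuousOnInterval

theorem le_mul_exp_of_ae_hasDerivAt_le {Y : ℝ → ℝ} {a b β : ℝ} (hab : a ≤ b)
    (hY : AbsolutelyContinuousOnInterval Y a b)
    (hd : ∀ᵐ t, t ∈ Ioo a b → ∃ y', HasDerivAt Y y' t ∧ y' ≤ -β * Y t) :
    Y b ≤ Y a * Real.exp (-β * (b - a)) := by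
  set e : ℝ → ℝ := fun t => Real.exp (β * (t - a)) with he
  have hprod := ((ContDiff.contDiffOn (by fun_prop : ContDiff ℝ 1 e)
    ).absolutelyContinuousOnInterval.mul hY).integral_deriv_eq_sub
  have hle : ∫ t in a..b, deriv (e * Y) t ≤ 0 := by
    rw [intervalIntegral.integral_of_le hab, integral_Ioc_eq_integral_Ioo]
    apply setIntegral_nonpos_of_ae_restrict
    rw [EventuallyLE, ae_restrict_iff' measurableSet_Ioo]
    filter_upwards [hd] with t ht htm
    obtain ⟨y', hy', hle⟩ := ht htm
    have hde : HasDerivAt e (e t * β) t := by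
      simpa using (((hasDerivAt_id t).sub_const a).const_mul β).exp
    rw [(hde.mul hy').deriv, Pi.zero_apply]
    nlinarith [Real.exp_pos (β * (t - a))]
  have hgrow : e b * Y b ≤ Y a := by
    simpa [he] using hprod.symm.trans_le hle
  have hinv : e b * Real.exp (-β * (b - a)) = 1 := by simp [he, ← Real.exp_add]
  calc Y b = e b * Y b * Real.exp (-β * (b - a)) := by rw [mul_right_comm, hinv, one_mul]
    _ ≤ Y a * Real.exp (-β * (b - a)) := by gcongr

theorem sq_integral_le {g : ℝ → ℝ} {a b : ℝ} (hab : a ≤ b)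
    (hg : IntervalIntegrable g volume a b)
    (hg2 : IntervalIntegrable (fun s => g s ^ 2) volume a b) :
    (∫ s in a..b, g s) ^ 2 ≤ (b - a) * ∫ s in a..b, g s ^ 2 := by
  rcases hab.eq_or_lt with rfl | hlt
  · simp
  set I := ∫ s in a..b, g s
  set mean := I / (b - a)
  have hvar : 0 ≤ ∫ s in a..b, (g s - mean) ^ 2 :=
    intervalIntegral.integral_nonneg hab fun s _ => sq_nonneg _
  have hexpand : ∫ s in a..b, (g s - mean) ^ 2 =
      (∫ s in a..b, g s ^ 2) - 2 * mean * I + (b - a) * mean ^ 2 := by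
    have : ∀ s, (g s - mean) ^ 2 = g s ^ 2 - (2 * mean) * g s + mean ^ 2 := fun s => by ring
    simp_rw [this]
    rw [intervalIntegral.integral_add (hg2.sub (hg.const_mul _)) (by simp),
      intervalIntegral.integral_sub hg2 (hg.const_mul _), intervalIntegral.integral_const_mul]
    simp [I]
  have hba : 0 < b - a := sub_pos.2 hlt
  have hmean : mean * (b - a) = I := div_mul_cancel₀ _ hba.ne'
  have := mul_nonneg hba.le (hvar.trans_eq hexpand)
  nlinarith

theorem norm_integral_sq_le {g : ℝ → E} {a b : ℝ} (hab : a ≤ b)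
    (hg : IntervalIntegrable g volume a b)
    (hg2 : IntervalIntegrable (fun s => ‖g s‖ ^ 2) volume a b) :
    ‖∫ s in a..b, g s‖ ^ 2 ≤ (b - a) * ∫ s in a..b, ‖g s‖ ^ 2 :=
  (pow_le_pow_left₀ (norm_nonneg _) (intervalIntegral.norm_integral_le_integral_norm hab) 2).trans
    (sq_integral_le hab hg.norm hg2)

theorem stronglyMeasurable_switch {E ι Ω : Type*} [NormedAddCommGroup E] [Finite ι]
    [MeasurableSpace Ω] {σ : Ω → ι} (hσ : ∀ ℓ, MeasurableSet (σ ⁻¹' {ℓ}))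
    {g : ι → Ω → E} (hg : ∀ ℓ, StronglyMeasurable (g ℓ)) :
    StronglyMeasurable fun s => g (σ s) s := by
  classical
  have := Fintype.ofFinite ι
  have hsum : (fun s => g (σ s) s) = fun s => ∑ ℓ, (σ ⁻¹' {ℓ}).indicator (g ℓ) s := by
    ext s
    simp [indicator_apply]
  rw [hsum]
  exact Finset.stronglyMeasurable_fun_sum _ fun ℓ _ => (hg ℓ).indicator (hσ ℓ)

end Analysis

section DelayMemory

variable {F : ℝ → ℝ} {h : ℝ}

/-- The delay term of a Lyapunov–Krasovskii functional. For `F' = q` it is the double integral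
`∫ s in (t - h)..t, ∫ u in s..t, q u`; storing it through the primitive `F` avoids double
integrals. -/
noncomputable def delayMemory (F : ℝ → ℝ) (h t : ℝ) : ℝ :=
  ∫ s in (t - h)..t, (F t - F s)

theorem delayMemory_eq (hF : Continuous F) (h t : ℝ) :
    delayMemory F h t = h * F t - ((∫ s in (0 : ℝ)..t, F s) - ∫ s in (0 : ℝ)..(t - h), F s) := by
  rw [delayMemory, intervalIntegral.integral_sub (by simp) (hF.intervalIntegrable _ _),
    intervalIntegral.integral_interval_sub_left (hF.intervalIntegrable _ _)
      (hF.intervalIntegrable _ _)]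
  simp

theorem delayMemory_nonneg (hF : Monotone F) (hh : 0 ≤ h) (t : ℝ) : 0 ≤ delayMemory F h t :=
  intervalIntegral.integral_nonneg (by linarith) fun _ hs => sub_nonneg.2 (hF hs.2)

theorem delayMemory_le (hF : Continuous F) (hmono : Monotone F) (hh : 0 ≤ h) (t : ℝ) :
    delayMemory F h t ≤ h * (F t - F (t - h)) := by
  have hle : delayMemory F h t ≤ ∫ _ in (t - h)..t, (F t - F (t - h)) :=
    intervalIntegral.integral_mono_on (by linarith)
      ((continuous_const.sub hF).intervalIntegrable _ _) (by simp)
      fun s hs => sub_le_sub_left (hmono hs.1) _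
  simpa [mul_sub] using hle

theorem hasDerivAt_delayMemory (hF : Continuous F) {q t : ℝ} (hq : HasDerivAt F q t) :
    HasDerivAt (delayMemory F h) (h * q - (F t - F (t - h))) t := by
  have hprim : ∀ u, HasDerivAt (fun u => ∫ s in (0 : ℝ)..u, F s) (F u) u := fun u =>
    intervalIntegral.integral_hasDerivAt_right (hF.intervalIntegrable _ _)
      (hF.stronglyMeasurableAtFilter _ _) hF.continuousAt
  refine (((hq.const_mul h).sub ((hprim t).sub
    ((hprim (t - h)).comp_sub_const t h)))).congr_of_eventuallyEq ?_
  exact Eventually.of_forall fun u => delayMemory_eq hF h u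

theorem absolutelyContinuousOnInterval_delayMemory {K : ℝ≥0} (hF : LipschitzWith K F) (a b : ℝ) :
    AbsolutelyContinuousOnInterval (delayMemory F h) a b := by
  have hcont := hF.continuous
  have hprim : ContDiff ℝ 1 fun u => ∫ s in (0 : ℝ)..u, F s := by
    rw [contDiff_one_iff_deriv]
    refine ⟨intervalIntegral.differentiable_integral_of_continuous hcont, ?_⟩
    simpa only [funext fun u => hcont.deriv_integral F 0 u]
  have hshift : ContDiff ℝ 1 fun t => (∫ s in (0 : ℝ)..t, F s) - ∫ s in (0 : ℝ)..(t - h), F s :=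
    hprim.sub (hprim.comp (contDiff_id.sub contDiff_const))
  rw [funext (delayMemory_eq hcont h)]
  exact ((hF.lipschitzOnWith.absolutelyContinuousOnInterval).const_mul h).fun_sub
    hshift.contDiffOn.absolutelyContinuousOnInterval

end DelayMemory

section Stability

variable {J E : Type*} [NormedAddCommGroup E] {h : ℝ} {Sol : J → ℝ → ℝ → (ℝ → E) → Prop}

/-- Local uniform exponential stability of the zero equilibrium, in the setting of `IsLUAS`:
solutions with initial function of size `δ ≤ δ₀` stay below `C δ exp (-β (t - t₀))`. -/
structure IsLUES (h : ℝ) (Sol : J → ℝ → ℝ → (ℝ → E) → Prop) : Prop where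
  equilibrium : ∀ j t₀ t₁, 0 ≤ t₀ → t₀ ≤ t₁ → Sol j t₀ t₁ fun _ => 0
  decay : ∃ δ₀ > 0, ∃ C > 0, ∃ β > 0, ∀ j t₀ t₁ z δ, 0 ≤ t₀ → t₀ ≤ t₁ → Sol j t₀ t₁ z → δ ≤ δ₀ →
    (∀ s ∈ Icc (t₀ - h) t₀, ‖z s‖ ≤ δ) →
      ∀ t ∈ Icc t₀ t₁, ‖z t‖ ≤ C * δ * Real.exp (-β * (t - t₀))

theorem IsLUES.isLUAS (hSol : IsLUES h Sol) : IsLUAS h Sol := by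
  obtain ⟨δ₀, hδ₀, C, hC, β, hβ, hdecay⟩ := hSol.decay
  refine ⟨hSol.equilibrium, fun ε hε => ?_, δ₀, hδ₀, fun ε hε => ?_⟩
  · set δ := min δ₀ (ε / (2 * C))
    have hδ : 0 < δ := lt_min hδ₀ (by positivity)
    refine ⟨δ, hδ, fun j t₀ t₁ z h₀ h₀₁ hz hist t ht => ?_⟩
    have hexp : Real.exp (-β * (t - t₀)) ≤ 1 := Real.exp_le_one_iff.2 (by nlinarith [ht.1])
    calc ‖z t‖ ≤ C * δ * Real.exp (-β * (t - t₀)) :=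
          hdecay j t₀ t₁ z δ h₀ h₀₁ hz (min_le_left _ _) (fun s hs => (hist s hs).le) t ht
      _ ≤ C * (ε / (2 * C)) * 1 := by gcongr; exact min_le_right _ _
      _ = ε / 2 := by field_simp
      _ < ε := half_lt_self hε
  · have hlim : Tendsto (fun T : ℝ => C * δ₀ * Real.exp (-β * T)) atTop (𝓝 0) := by
      simpa using (Real.tendsto_exp_atBot.comp
        (tendsto_id.const_mul_atTop_of_neg (neg_neg_of_pos hβ))).const_mul (C * δ₀)
    obtain ⟨T, hTε, hT⟩ := ((hlim.eventually_lt_const hε).and (eventually_gt_atTop 0)).exists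
    refine ⟨T, hT, fun j t₀ t₁ z h₀ h₀₁ hz hist t ht => ?_⟩
    have hTt : T ≤ t - t₀ := by linarith [ht.1]
    calc ‖z t‖ ≤ C * δ₀ * Real.exp (-β * (t - t₀)) :=
          hdecay j t₀ t₁ z δ₀ h₀ h₀₁ hz le_rfl (fun s hs => (hist s hs).le) t
            ⟨by linarith, ht.2⟩
      _ ≤ C * δ₀ * Real.exp (-β * T) := by
          gcongr C * δ₀ * Real.exp ?_
          nlinarith
      _ < ε := hTε

end Stability

section Arcs

variable {E F : Type*} [NormedAddCommGroup E] [NormedSpace ℝ E]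
  [NormedAddCommGroup F] [NormedSpace ℝ F]
  {z w : ℝ → E} {t₀ t₁ : ℝ} {K : ℝ≥0}

/-- The arc `z` moves on `[t₀, t₁]` with velocity `w`, in the sense of Carathéodory. The velocity
is defined on all of `ℝ` and vanishes before `t₀`, where `z` is merely an initial function. -/
structure IsArc (z w : ℝ → E) (t₀ t₁ : ℝ) (K : ℝ≥0) : Prop where
  stronglyMeasurable : StronglyMeasurable w
  norm_le : ∀ t, ‖w t‖ ≤ K
  eq_zero : ∀ t ≤ t₀, w t = 0
  eq_integral : ∀ t ∈ Icc t₀ t₁, z t = z t₀ + ∫ s in t₀..t, w s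

/-- The action `∫ ‖w‖²` of a velocity `w`, counted from time `t₀`. -/
noncomputable def action (w : ℝ → E) (t₀ t : ℝ) : ℝ :=
  ∫ s in t₀..t, ‖w s‖ ^ 2

namespace IsArc

theorem intervalIntegrable (hz : IsArc z w t₀ t₁ K) (a b : ℝ) :
    IntervalIntegrable w volume a b :=
  intervalIntegrable_iff.2 <| Measure.integrableOn_of_bounded (by simp)
    hz.stronglyMeasurable.aestronglyMeasurable (ae_of_all _ hz.norm_le)

theorem norm_sq_le (hz : IsArc z w t₀ t₁ K) (t : ℝ) : ‖‖w t‖ ^ 2‖ ≤ (K ^ 2 : ℝ≥0) := by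
  rw [norm_pow, norm_norm, NNReal.coe_pow]
  exact pow_le_pow_left₀ (norm_nonneg _) (hz.norm_le t) 2

theorem intervalIntegrable_norm_sq (hz : IsArc z w t₀ t₁ K) (a b : ℝ) :
    IntervalIntegrable (fun s => ‖w s‖ ^ 2) volume a b :=
  intervalIntegrable_iff.2 <| Measure.integrableOn_of_bounded (by simp)
    (hz.stronglyMeasurable.norm.pow 2).aestronglyMeasurable (ae_of_all _ hz.norm_sq_le)

theorem sub_eq_integral (hz : IsArc z w t₀ t₁ K) {s t : ℝ} (hs : s ∈ Icc t₀ t₁)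
    (ht : t ∈ Icc t₀ t₁) : z t - z s = ∫ u in s..t, w u := by
  rw [hz.eq_integral t ht, hz.eq_integral s hs, add_sub_add_left_eq_sub,
    intervalIntegral.integral_interval_sub_left (hz.intervalIntegrable _ _)
      (hz.intervalIntegrable _ _)]

theorem lipschitzOnWith (hz : IsArc z w t₀ t₁ K) : LipschitzOnWith K z (Icc t₀ t₁) :=
  LipschitzOnWith.of_dist_le_mul fun s hs t ht => by
    rw [dist_eq_norm, hz.sub_eq_integral ht hs, Real.dist_eq]
    exact intervalIntegral.norm_integral_le_of_norm_le_const fun u _ => hz.norm_le u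

theorem ae_hasDerivAt [CompleteSpace E] (hz : IsArc z w t₀ t₁ K) :
    ∀ᵐ t, t ∈ Ioo t₀ t₁ → HasDerivAt z (w t) t := by
  filter_upwards [(hz.intervalIntegrable t₀ t₁).ae_hasDerivAt_integral] with t ht htm
  have hmem : t ∈ uIcc t₀ t₁ := Icc_subset_uIcc (Ioo_subset_Icc_self htm)
  refine ((ht hmem t₀ left_mem_uIcc).const_add (z t₀)).congr_of_eventuallyEq ?_
  filter_upwards [Icc_mem_nhds htm.1 htm.2] with s hs using hz.eq_integral s hs

theorem clm_comp [CompleteSpace E] [CompleteSpace F] (hz : IsArc z w t₀ t₁ K) (π : E →L[ℝ] F) :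
    IsArc (fun t => π (z t)) (fun t => π (w t)) t₀ t₁ (‖π‖₊ * K) where
  stronglyMeasurable := π.continuous.comp_stronglyMeasurable hz.stronglyMeasurable
  norm_le t := by
    simpa using (π.le_opNorm (w t)).trans
      (mul_le_mul_of_nonneg_left (hz.norm_le t) (norm_nonneg π))
  eq_zero t ht := by rw [hz.eq_zero t ht, map_zero]
  eq_integral t ht := by
    rw [π.intervalIntegral_comp_comm (hz.intervalIntegrable _ _), hz.eq_integral t ht, map_add]

theorem action_sub (hz : IsArc z w t₀ t₁ K) (s t : ℝ) :
    action w t₀ t - action w t₀ s = ∫ u in s..t, ‖w u‖ ^ 2 :=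
  intervalIntegral.integral_interval_sub_left (hz.intervalIntegrable_norm_sq _ _)
    (hz.intervalIntegrable_norm_sq _ _)

theorem monotone_action (hz : IsArc z w t₀ t₁ K) : Monotone (action w t₀) := fun s t hst => by
  rw [← sub_nonneg, hz.action_sub]
  exact intervalIntegral.integral_nonneg hst fun _ _ => sq_nonneg _

theorem lipschitzWith_action (hz : IsArc z w t₀ t₁ K) : LipschitzWith (K ^ 2) (action w t₀) :=
  LipschitzWith.of_dist_le_mul fun s t => by
    rw [dist_eq_norm, hz.action_sub, Real.dist_eq]
    exact intervalIntegral.norm_integral_le_of_norm_le_const fun u _ => hz.norm_sq_le u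

theorem action_eq_zero (hz : IsArc z w t₀ t₁ K) {t : ℝ} (ht : t ≤ t₀) : action w t₀ t = 0 := by
  rw [action, intervalIntegral.integral_symm, neg_eq_zero]
  refine intervalIntegral.integral_zero_ae (ae_of_all _ fun s hs => ?_)
  rw [uIoc_of_le ht] at hs
  simp [hz.eq_zero s hs.2]

theorem ae_hasDerivAt_action (hz : IsArc z w t₀ t₁ K) :
    ∀ᵐ t, t ∈ Ioo t₀ t₁ → HasDerivAt (action w t₀) (‖w t‖ ^ 2) t := by
  filter_upwards [(hz.intervalIntegrable_norm_sq t₀ t₁).ae_hasDerivAt_integral] with t ht htm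
  exact ht (Icc_subset_uIcc (Ioo_subset_Icc_self htm)) t₀ left_mem_uIcc

theorem norm_sub_sq_le (hz : IsArc z w t₀ t₁ K) {s t : ℝ} (hs : s ∈ Icc t₀ t₁)
    (ht : t ∈ Icc t₀ t₁) (hst : s ≤ t) :
    ‖z t - z s‖ ^ 2 ≤ (t - s) * (action w t₀ t - action w t₀ s) := by
  rw [hz.sub_eq_integral hs ht, hz.action_sub]
  exact norm_integral_sq_le hst (hz.intervalIntegrable _ _) (hz.intervalIntegrable_norm_sq _ _)

theorem norm_sub_sq_le_of_history (hz : IsArc z w t₀ t₁ K) {h b δ : ℝ} (hb : 0 ≤ b)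
    (hist : ∀ s ∈ Icc (t₀ - h) t₀, ‖z s‖ ≤ δ) {s t : ℝ} (ht : t ∈ Icc t₀ t₁)
    (hs : s ∈ Icc (t - h) t) :
    ‖z t - z s‖ ^ 2 ≤ 2 * h * (action w t₀ t - action w t₀ (t - h)) +
      8 * δ ^ 2 * Real.exp (b * (h - (t - t₀))) := by
  have hmono := hz.monotone_action
  have hh : 0 ≤ h := by linarith [hs.1, hs.2]
  rcases le_or_gt t₀ s with hs₀ | hs₀
  · have hexp := Real.exp_pos (b * (h - (t - t₀)))
    calc ‖z t - z s‖ ^ 2 ≤ (t - s) * (action w t₀ t - action w t₀ s) :=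
          hz.norm_sub_sq_le ⟨hs₀, hs.2.trans ht.2⟩ ht hs.2
      _ ≤ h * (action w t₀ t - action w t₀ (t - h)) := by
          gcongr
          · exact sub_nonneg.2 (hmono hs.2)
          · linarith [hs.1]
          · exact hmono hs.1
      _ ≤ _ := by nlinarith [sub_nonneg.2 (hmono (by linarith : t - h ≤ t)), sq_nonneg δ]
  · have ht₀ : t₀ ∈ Icc t₀ t₁ := ⟨le_rfl, ht.1.trans ht.2⟩
    have hmove : ‖z t - z t₀‖ ^ 2 ≤ h * (action w t₀ t - action w t₀ (t - h)) := by
      rw [hz.action_eq_zero (t := t - h) (by linarith [hs.1]),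
        ← hz.action_eq_zero (le_refl t₀)]
      exact (hz.norm_sub_sq_le ht₀ ht ht.1).trans (mul_le_mul_of_nonneg_right
        (by linarith [hs.1]) (sub_nonneg.2 (hmono ht.1)))
    have hpast : ‖z t₀ - z s‖ ≤ 2 * δ := by
      have h₁ := hist t₀ ⟨by linarith, le_rfl⟩
      have h₂ := hist s ⟨by linarith [hs.1, ht.1], hs₀.le⟩
      linarith [norm_sub_le (z t₀) (z s)]
    have hexp : 1 ≤ Real.exp (b * (h - (t - t₀))) :=
      Real.one_le_exp (mul_nonneg hb (by linarith [hs.1]))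
    calc ‖z t - z s‖ ^ 2 = ‖(z t - z t₀) + (z t₀ - z s)‖ ^ 2 := by rw [sub_add_sub_cancel]
      _ ≤ (‖z t - z t₀‖ + ‖z t₀ - z s‖) ^ 2 := by gcongr; exact norm_add_le _ _
      _ ≤ 2 * (‖z t - z t₀‖ ^ 2 + ‖z t₀ - z s‖ ^ 2) := add_sq_le
      _ ≤ 2 * (h * (action w t₀ t - action w t₀ (t - h)) + (2 * δ) ^ 2) := by gcongr
      _ ≤ _ := by nlinarith [sq_nonneg δ]

end IsArc

end Arcs

section DelayField

variable {E ι : Type*} [NormedAddCommGroup E] [Finite ι] {f : ι → E → E → E} {h : ℝ}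

theorem exists_norm_le_of_isCompact (hf : ∀ ℓ, Continuous fun p : E × E => f ℓ p.1 p.2)
    {S : Set E} (hS : IsCompact S) : ∃ K : ℝ≥0, ∀ ℓ, ∀ x ∈ S, ∀ y ∈ S, ‖f ℓ x y‖ ≤ K := by
  choose K hK using fun ℓ => (hS.prod hS).exists_bound_of_continuousOn (hf ℓ).continuousOn
  obtain ⟨b, hb⟩ := (finite_range K).bddAbove
  exact ⟨b.toNNReal, fun ℓ x hx y hy =>
    ((hK ℓ (x, y) ⟨hx, hy⟩).trans (hb ⟨ℓ, rfl⟩)).trans (Real.le_coe_toNNReal b)⟩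

theorem stronglyMeasurable_delayField
    (hf : ∀ ℓ, Continuous fun p : E × E => f ℓ p.1 p.2) (j : Signal ι h) {z : ℝ → E}
    (hz : Continuous z) : StronglyMeasurable fun s => f (j.σ s) (z s) (z (s - j.τ s)) :=
  stronglyMeasurable_switch j.σ_meas fun ℓ => (hf ℓ).comp_stronglyMeasurable <|
    hz.stronglyMeasurable.prodMk <|
      hz.stronglyMeasurable.comp_measurable (measurable_id.sub j.τ_meas)

end DelayField

section LyapunovKrasovskii

variable {E F : Type*} [NormedAddCommGroup E] [NormedSpace ℝ E] [NormedAddCommGroup F]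
  [NormedSpace ℝ F] {ι : Type*} {f : ι → E → E → E} {π : E →L[ℝ] F} {V : E → ℝ}
  {h r c₁ c₂ α γ ν : ℝ}

/-- `z` solves the switched delay equation `z' = f σ(t) (z t) (z (t - τ t))` on `[t₀, t₁]` in the
sense of Carathéodory. -/
def IsDelaySolution (f : ι → E → E → E) (h : ℝ) (j : Signal ι h) (t₀ t₁ : ℝ) (z : ℝ → E) : Prop :=
  ContinuousOn z (Icc (t₀ - h) t₁) ∧
    ∀ t ∈ Icc t₀ t₁, z t = z t₀ + ∫ s in t₀..t, f (j.σ s) (z s) (z (s - j.τ s))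

theorem IsDelaySolution.mono {j : Signal ι h} {t₀ t₁ t : ℝ} {z : ℝ → E}
    (hz : IsDelaySolution f h j t₀ t₁ z) (ht : t ≤ t₁) : IsDelaySolution f h j t₀ t z :=
  ⟨hz.1.mono (Icc_subset_Icc_right ht), fun s hs => hz.2 s ⟨hs.1, hs.2.trans ht⟩⟩

theorem IsDelaySolution.exists_isArc [Finite ι]
    (hf : ∀ ℓ, Continuous fun p : E × E => f ℓ p.1 p.2) {j : Signal ι h} {t₀ t₁ : ℝ} {z : ℝ → E}
    (hz : IsDelaySolution f h j t₀ t₁ z) (hh : 0 ≤ h) (h₀₁ : t₀ ≤ t₁) :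
    ∃ (w : ℝ → E) (K : ℝ≥0), IsArc z w t₀ t₁ K ∧
      ∀ t ∈ Ioc t₀ t₁, w t = f (j.σ t) (z t) (z (t - j.τ t)) := by
  have hle : t₀ - h ≤ t₁ := by linarith
  obtain ⟨K, hK⟩ := exists_norm_le_of_isCompact hf (isCompact_Icc.image_of_continuousOn hz.1)
  have hmem : ∀ s ∈ Ioc t₀ t₁, s ∈ Icc (t₀ - h) t₁ ∧ s - j.τ s ∈ Icc (t₀ - h) t₁ := fun s hs =>
    ⟨⟨by linarith [hs.1], hs.2⟩, by linarith [hs.1, (j.τ_mem s).2],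
      by linarith [hs.2, (j.τ_mem s).1]⟩
  set v : ℝ → E := fun s => f (j.σ s) (z s) (z (s - j.τ s))
  have hmeas : StronglyMeasurable ((Ioc t₀ t₁).indicator v) := by
    have hext := (stronglyMeasurable_delayField hf j
      ((continuousOn_iff_continuous_domRestrict.1 hz.1).Icc_extend' (h := hle))).indicator
        (measurableSet_Ioc (a := t₀) (b := t₁))
    convert hext using 1
    refine indicator_congr fun s hs => ?_
    rw [IccExtend_of_mem _ _ (hmem s hs).1, IccExtend_of_mem _ _ (hmem s hs).2]
    rfl
  refine ⟨(Ioc t₀ t₁).indicator v, K, ⟨hmeas, fun t => ?_, fun t ht => ?_, fun t ht => ?_⟩,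
    fun t ht => indicator_of_mem ht v⟩
  · by_cases ht : t ∈ Ioc t₀ t₁
    · rw [indicator_of_mem ht]
      exact hK _ _ (mem_image_of_mem z (hmem t ht).1) _ (mem_image_of_mem z (hmem t ht).2)
    · simp [indicator_of_notMem ht]
  · exact indicator_of_notMem (fun h => h.1.not_ge ht) v
  · rw [hz.2 t ht, intervalIntegral.integral_of_le ht.1, intervalIntegral.integral_of_le ht.1]
    congr 1
    refine setIntegral_congr_fun measurableSet_Ioc fun s hs => ?_
    exact (indicator_of_mem (Ioc_subset_Ioc_right ht.2 hs) v).symm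

/-- A Lyapunov function for the family of delay equations `z' = f ℓ (z t) (z (t - τ t))` in the ball
of radius `r`. `π` observes the delayed part of the state; `γ` weighs the delay memory, and `ν` the
error made by evaluating `π` at a delayed time. -/
structure IsDelayLyapunov (f : ι → E → E → E) (π : E →L[ℝ] F) (V : E → ℝ)
    (h r c₁ c₂ α γ ν : ℝ) : Prop where
  contDiff : ContDiff ℝ 1 V
  radius_pos : 0 < r
  lower_pos : 0 < c₁
  upper_pos : 0 < c₂
  rate_pos : 0 < α
  mismatch_nonneg : 0 ≤ ν
  small_delay : 2 * h * ν < γ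
  lower : ∀ x, ‖x‖ ≤ r → c₁ * ‖x‖ ^ 2 ≤ V x
  upper : ∀ x, ‖x‖ ≤ r → V x ≤ c₂ * ‖x‖ ^ 2
  dissipation : ∀ ℓ x y, ‖x‖ ≤ r →
    fderiv ℝ V x (f ℓ x y) + γ * h * ‖π (f ℓ x y)‖ ^ 2 ≤ -α * ‖x‖ ^ 2 + ν * ‖π (x - y)‖ ^ 2

/-- The Lyapunov–Krasovskii functional along an arc `z` whose observed velocity has action `F`. The
last term absorbs the initial function, which need not have a velocity. -/
noncomputable def krasovskii (V : E → ℝ) (z : ℝ → E) (F : ℝ → ℝ) (γ h κ β t₀ t : ℝ) : ℝ :=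
  V (z t) + γ * delayMemory F h t + κ * Real.exp (-(2 * β) * (t - t₀))

theorem absolutelyContinuousOnInterval_krasovskii (hV : ContDiff ℝ 1 V) {z : ℝ → E} {t₀ t : ℝ}
    {K L : ℝ≥0} (hz : LipschitzOnWith K z (uIcc t₀ t)) {F : ℝ → ℝ} (hF : LipschitzWith L F)
    (γ h κ β : ℝ) :
    AbsolutelyContinuousOnInterval (krasovskii V z F γ h κ β t₀) t₀ t := by
  have hexp : ContDiff ℝ 1 fun t : ℝ => κ * Real.exp (-(2 * β) * (t - t₀)) := by fun_prop
  exact ((absolutelyContinuousOnInterval_contDiff_comp hV hz).fun_add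
    ((absolutelyContinuousOnInterval_delayMemory hF _ _).const_mul γ)).fun_add
      hexp.contDiffOn.absolutelyContinuousOnInterval

theorem hasDerivAt_krasovskii (hV : ContDiff ℝ 1 V) {z : ℝ → E} {v : E} {F : ℝ → ℝ} {q t : ℝ}
    (hz : HasDerivAt z v t) (hF : Continuous F) (hq : HasDerivAt F q t) (γ h κ β t₀ : ℝ) :
    HasDerivAt (krasovskii V z F γ h κ β t₀)
      (fderiv ℝ V (z t) v + γ * (h * q - (F t - F (t - h))) -
        2 * β * (κ * Real.exp (-(2 * β) * (t - t₀)))) t := by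
  have hexp : HasDerivAt (fun t : ℝ => κ * Real.exp (-(2 * β) * (t - t₀)))
      (-(2 * β * (κ * Real.exp (-(2 * β) * (t - t₀))))) t := by
    refine ((((hasDerivAt_id t).sub_const t₀).const_mul (-(2 * β))).exp.const_mul κ).congr_deriv ?_
    simp only [id_eq]
    ring
  have hVz := (hV.differentiable one_ne_zero (z t)).hasFDerivAt.comp_hasDerivAt t hz
  exact (hVz.add ((hasDerivAt_delayMemory hF hq).const_mul γ)).add hexp

namespace IsDelayLyapunov

variable {β κ δ t₀ t₁ : ℝ} {z w : ℝ → E} {K : ℝ≥0}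

theorem exists_decayRate (hV : IsDelayLyapunov f π V h r c₁ c₂ α γ ν) (hh : 0 ≤ h) :
    ∃ β > 0, β * c₂ ≤ α ∧ β * γ * h ≤ γ - 2 * h * ν := by
  have hγ : 0 ≤ γ := (mul_nonneg (by positivity) hV.mismatch_nonneg).trans hV.small_delay.le
  have hgap := sub_pos.2 hV.small_delay
  have hc₂ := hV.upper_pos
  have hα := hV.rate_pos
  refine ⟨min (α / c₂) ((γ - 2 * h * ν) / (γ * h + 1)), lt_min (by positivity) (by positivity),
    (le_div_iff₀ hc₂).1 (min_le_left _ _), ?_⟩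
  have hmin := (le_div_iff₀ (by positivity : 0 < γ * h + 1)).1
    (min_le_right (α / c₂) ((γ - 2 * h * ν) / (γ * h + 1)))
  have : 0 ≤ min (α / c₂) ((γ - 2 * h * ν) / (γ * h + 1)) := by positivity
  nlinarith

theorem deriv_krasovskii_le (hV : IsDelayLyapunov f π V h r c₁ c₂ α γ ν) (hh : 0 ≤ h)
    (hβ : 0 < β) (hβα : β * c₂ ≤ α) (hβγ : β * γ * h ≤ γ - 2 * h * ν)
    (hκ : 8 * ν * (‖π‖ * δ) ^ 2 * Real.exp (2 * β * h) ≤ β * κ) {ℓ : ι} {x y : E} (hx : ‖x‖ ≤ r)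
    {m Δ e : ℝ} (hm : m ≤ h * Δ) (hΔ : 0 ≤ Δ) (he : 0 ≤ e)
    (hxy : ‖π (x - y)‖ ^ 2 ≤ 2 * h * Δ + 8 * (‖π‖ * δ) ^ 2 * (Real.exp (2 * β * h) * e)) :
    fderiv ℝ V x (f ℓ x y) + γ * (h * ‖π (f ℓ x y)‖ ^ 2 - Δ) - 2 * β * (κ * e) ≤
      -β * (V x + γ * m + κ * e) := by
  have hγ : 0 ≤ γ := (mul_nonneg (by positivity) hV.mismatch_nonneg).trans hV.small_delay.le
  have hVx : β * V x ≤ α * ‖x‖ ^ 2 :=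
    calc β * V x ≤ β * (c₂ * ‖x‖ ^ 2) := by gcongr; exact hV.upper x hx
      _ = β * c₂ * ‖x‖ ^ 2 := by ring
      _ ≤ α * ‖x‖ ^ 2 := by gcongr
  have hmemory : β * γ * m ≤ (γ - 2 * h * ν) * Δ :=
    calc β * γ * m ≤ β * γ * (h * Δ) := by gcongr
      _ = β * γ * h * Δ := by ring
      _ ≤ (γ - 2 * h * ν) * Δ := by gcongr
  have hdelay := mul_le_mul_of_nonneg_left hxy hV.mismatch_nonneg
  have hpast := mul_le_mul_of_nonneg_right hκ he
  linarith [hV.dissipation ℓ x y hx]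

theorem krasovskii_le (hV : IsDelayLyapunov f π V h r c₁ c₂ α γ ν) [CompleteSpace E]
    [CompleteSpace F] (hβ : 0 < β) (hβα : β * c₂ ≤ α)
    (hβγ : β * γ * h ≤ γ - 2 * h * ν)
    (hκ : 8 * ν * (‖π‖ * δ) ^ 2 * Real.exp (2 * β * h) ≤ β * κ) {j : Signal ι h}
    (hz : IsArc z w t₀ t₁ K) (h₀₁ : t₀ ≤ t₁)
    (hw : ∀ t ∈ Ioc t₀ t₁, w t = f (j.σ t) (z t) (z (t - j.τ t)))
    (hist : ∀ s ∈ Icc (t₀ - h) t₀, ‖z s‖ ≤ δ) (hr : ∀ t ∈ Icc t₀ t₁, ‖z t‖ ≤ r) :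
    krasovskii V z (action (fun t => π (w t)) t₀) γ h κ β t₀ t₁ ≤
      krasovskii V z (action (fun t => π (w t)) t₀) γ h κ β t₀ t₀ * Real.exp (-β * (t₁ - t₀)) := by
  have hh : 0 ≤ h := (j.τ_mem 0).1.trans (j.τ_mem 0).2
  have hπz := hz.clm_comp π
  have hΦ := hπz.lipschitzWith_action
  have hlip : LipschitzOnWith K z (uIcc t₀ t₁) := by
    rw [uIcc_of_le h₀₁]
    exact hz.lipschitzOnWith
  refine le_mul_exp_of_ae_hasDerivAt_le h₀₁
    (absolutelyContinuousOnInterval_krasovskii hV.contDiff hlip hΦ _ _ _ _) ?_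
  filter_upwards [hz.ae_hasDerivAt, hπz.ae_hasDerivAt_action] with t hzt hΦt ht
  have htc := Ioo_subset_Icc_self ht
  refine ⟨_, hasDerivAt_krasovskii hV.contDiff (hzt ht) hΦ.continuous (hΦt ht) _ _ _ _ _, ?_⟩
  rw [hw t (Ioo_subset_Ioc_self ht)]
  refine hV.deriv_krasovskii_le hh hβ hβα hβγ hκ (hr t htc)
    (delayMemory_le hΦ.continuous hπz.monotone_action hh t)
    (sub_nonneg.2 (hπz.monotone_action (by linarith))) (Real.exp_pos _).le ?_
  have hmismatch := hπz.norm_sub_sq_le_of_history (b := 2 * β) (δ := ‖π‖ * δ) (by positivity)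
    (fun s hs => (π.le_opNorm _).trans (by gcongr; exact hist s hs)) htc
    (s := t - j.τ t) ⟨by linarith [(j.τ_mem t).2], by linarith [(j.τ_mem t).1]⟩
  have hexp : Real.exp (2 * β * (h - (t - t₀))) =
      Real.exp (2 * β * h) * Real.exp (-(2 * β) * (t - t₀)) := by
    rw [← Real.exp_add]
    ring_nf
  rwa [← map_sub, hexp] at hmismatch

theorem krasovskii_initial_le (hV : IsDelayLyapunov f π V h r c₁ c₂ α γ ν) [CompleteSpace E]
    [CompleteSpace F] (hh : 0 ≤ h) (hz : IsArc z w t₀ t₁ K) (hδ : ‖z t₀‖ ≤ δ) (hr : ‖z t₀‖ ≤ r) :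
    krasovskii V z (action (fun t => π (w t)) t₀) γ h κ β t₀ t₀ ≤ c₂ * δ ^ 2 + κ := by
  have hπz := hz.clm_comp π
  have hγ : 0 ≤ γ := (mul_nonneg (by positivity) hV.mismatch_nonneg).trans hV.small_delay.le
  have hmemory : delayMemory (action (fun t => π (w t)) t₀) h t₀ ≤ 0 := by
    simpa [hπz.action_eq_zero (le_refl t₀), hπz.action_eq_zero (t := t₀ - h) (by linarith)]
      using delayMemory_le hπz.lipschitzWith_action.continuous hπz.monotone_action hh t₀
  have hVz : V (z t₀) ≤ c₂ * δ ^ 2 := (hV.upper _ hr).trans (by have := hV.upper_pos; gcongr)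
  simp only [krasovskii, sub_self, mul_zero, Real.exp_zero, mul_one]
  linarith [mul_nonpos_of_nonneg_of_nonpos hγ hmemory]

theorem lower_le_krasovskii (hV : IsDelayLyapunov f π V h r c₁ c₂ α γ ν) [CompleteSpace E]
    [CompleteSpace F] (hh : 0 ≤ h) (hκ : 0 ≤ κ) (hz : IsArc z w t₀ t₁ K) {t : ℝ}
    (hr : ‖z t‖ ≤ r) :
    c₁ * ‖z t‖ ^ 2 ≤ krasovskii V z (action (fun t => π (w t)) t₀) γ h κ β t₀ t := by
  have hγ : 0 ≤ γ := (mul_nonneg (by positivity) hV.mismatch_nonneg).trans hV.small_delay.le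
  have hmemory := mul_nonneg hγ (delayMemory_nonneg (hz.clm_comp π).monotone_action hh t)
  have hpast := mul_nonneg hκ (Real.exp_pos (-(2 * β) * (t - t₀))).le
  rw [krasovskii]
  linarith [hV.lower _ hr]

theorem exists_exp_bound [Finite ι] [CompleteSpace E] [CompleteSpace F]
    (hV : IsDelayLyapunov f π V h r c₁ c₂ α γ ν) (hh : 0 ≤ h)
    (hf : ∀ ℓ, Continuous fun p : E × E => f ℓ p.1 p.2) :
    ∃ C > 0, ∃ β > 0, ∀ (j : Signal ι h) (t₀ t₁ : ℝ) (z : ℝ → E) (δ : ℝ), t₀ ≤ t₁ →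
      IsDelaySolution f h j t₀ t₁ z → (∀ s ∈ Icc (t₀ - h) t₀, ‖z s‖ ≤ δ) →
        (∀ t ∈ Icc t₀ t₁, ‖z t‖ ≤ r) → ‖z t₁‖ ≤ C * δ * Real.exp (-β * (t₁ - t₀)) := by
  obtain ⟨β, hβ, hβα, hβγ⟩ := hV.exists_decayRate hh
  have hν := hV.mismatch_nonneg
  have hc₁ := hV.lower_pos
  have hc₂ := hV.upper_pos
  set a := 8 * ν * ‖π‖ ^ 2 * Real.exp (2 * β * h) / β with ha
  refine ⟨√((c₂ + a) / c₁), by positivity, β / 2, by positivity,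
    fun j t₀ t₁ z δ h₀₁ hz hist hr => ?_⟩
  obtain ⟨w, K, hzw, hw⟩ := hz.exists_isArc hf hh h₀₁
  have hδ : ‖z t₀‖ ≤ δ := hist t₀ ⟨by linarith, le_rfl⟩
  have hδ₀ : 0 ≤ δ := (norm_nonneg _).trans hδ
  have hκ : 8 * ν * (‖π‖ * δ) ^ 2 * Real.exp (2 * β * h) ≤ β * (a * δ ^ 2) := by
    rw [ha]
    field_simp
    exact le_rfl
  have hsq : c₁ * ‖z t₁‖ ^ 2 ≤ (c₂ + a) * δ ^ 2 * Real.exp (-β * (t₁ - t₀)) :=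
    calc c₁ * ‖z t₁‖ ^ 2
        ≤ krasovskii V z (action (fun t => π (w t)) t₀) γ h (a * δ ^ 2) β t₀ t₁ :=
          hV.lower_le_krasovskii hh (by positivity) hzw (hr t₁ ⟨h₀₁, le_rfl⟩)
      _ ≤ krasovskii V z (action (fun t => π (w t)) t₀) γ h (a * δ ^ 2) β t₀ t₀ *
            Real.exp (-β * (t₁ - t₀)) :=
          hV.krasovskii_le hβ hβα hβγ hκ hzw h₀₁ hw hist hr
      _ ≤ (c₂ * δ ^ 2 + a * δ ^ 2) * Real.exp (-β * (t₁ - t₀)) := by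
          gcongr
          exact hV.krasovskii_initial_le hh hzw hδ (hr t₀ ⟨le_rfl, h₀₁⟩)
      _ = (c₂ + a) * δ ^ 2 * Real.exp (-β * (t₁ - t₀)) := by ring
  refine le_of_sq_le_sq ?_ (by positivity)
  have hexp : Real.exp (-(β / 2) * (t₁ - t₀)) ^ 2 = Real.exp (-β * (t₁ - t₀)) := by
    rw [← Real.exp_nat_mul]
    ring_nf
  rw [mul_pow, mul_pow, Real.sq_sqrt (by positivity), hexp, div_mul_eq_mul_div,
    div_mul_eq_mul_div, le_div_iff₀ hc₁]
  linarith

theorem isLUES [Finite ι] [CompleteSpace E] [CompleteSpace F]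
    (hV : IsDelayLyapunov f π V h r c₁ c₂ α γ ν) (hh : 0 ≤ h)
    (hf : ∀ ℓ, Continuous fun p : E × E => f ℓ p.1 p.2) (hf₀ : ∀ ℓ, f ℓ 0 0 = 0) :
    IsLUES h (IsDelaySolution f h) := by
  obtain ⟨C, hC, β, hβ, hbound⟩ := hV.exists_exp_bound hh hf
  have hr := hV.radius_pos
  refine ⟨fun j t₀ t₁ _ _ => ⟨continuousOn_const, fun t _ => by simp [hf₀]⟩,
    min r (r / (2 * C)), by positivity, C, hC, β, hβ, ?_⟩
  intro j t₀ t₁ z δ _ _ hz hδ hist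
  have hdecay : ∀ c ∈ Icc t₀ t₁, (∀ t ∈ Icc t₀ c, ‖z t‖ ≤ r) →
      ‖z c‖ ≤ C * δ * Real.exp (-β * (c - t₀)) := fun c hc =>
    hbound j t₀ c z δ hc.1 (hz.mono hc.2) hist
  have hz₀ : ‖z t₀‖ ≤ δ := hist t₀ ⟨by linarith, le_rfl⟩
  have htrap : ∀ t ∈ Icc t₀ t₁, ‖z t‖ < r := by
    refine lt_of_forall_le_imp_lt (hz.1.norm.mono (Icc_subset_Icc_left (by linarith)))
      (hz₀.trans (hδ.trans (min_le_left _ _))) fun c hc hrc => ?_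
    have hexp : Real.exp (-β * (c - t₀)) ≤ 1 := Real.exp_le_one_iff.2 (by nlinarith [hc.1])
    calc ‖z c‖ ≤ C * δ * Real.exp (-β * (c - t₀)) := hdecay c hc hrc
      _ ≤ C * (r / (2 * C)) * 1 := by
          have := (norm_nonneg _).trans hz₀
          gcongr
          exact hδ.trans (min_le_right _ _)
      _ = r / 2 := by field_simp
      _ < r := half_lt_self hr
  exact fun t ht => hdecay t ht fun s hs => (htrap s ⟨hs.1, hs.2.trans ht.2⟩).le

end IsDelayLyapunov

end LyapunovKrasovskii

/-- The Euclidean length of a vector in `n → ℝ`, a type whose own norm is the sup norm. -/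
noncomputable def l2Norm {n : Type*} [Fintype n] (x : n → ℝ) : ℝ :=
  ‖(WithLp.toLp 2 x : EuclideanSpace ℝ n)‖

local notation "‖" x "‖₂" => l2Norm x

section EuclideanLength

variable {m n : Type*} [Fintype m] [Fintype n]

theorem l2Norm_nonneg (x : n → ℝ) : 0 ≤ ‖x‖₂ := norm_nonneg _

theorem l2Norm_sq (x : n → ℝ) : ‖x‖₂ ^ 2 = x ⬝ᵥ x := by
  rw [l2Norm, EuclideanSpace.norm_sq_eq]
  simp [dotProduct, sq]

theorem l2Norm_pos {x : n → ℝ} (hx : x ≠ 0) : 0 < ‖x‖₂ :=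
  norm_pos_iff.2 fun h => hx (congrArg WithLp.ofLp h)

theorem l2Norm_sub_le (x y : n → ℝ) : ‖x - y‖₂ ≤ ‖x‖₂ + ‖y‖₂ := norm_sub_le _ _

theorem abs_dotProduct_le (x y : n → ℝ) : |x ⬝ᵥ y| ≤ ‖x‖₂ * ‖y‖₂ := by
  have := abs_real_inner_le_norm (WithLp.toLp 2 y : EuclideanSpace ℝ n) (WithLp.toLp 2 x)
  rwa [EuclideanSpace.inner_toLp_toLp, star_trivial, mul_comm] at this

theorem l2Norm_mulVec_le [DecidableEq n] (A : Matrix m n ℝ) (x : n → ℝ) :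
    ‖A *ᵥ x‖₂ ≤ ‖A‖ * ‖x‖₂ :=
  Matrix.l2_opNorm_mulVec A (WithLp.toLp 2 x)

theorem l2Norm_mul_le (D x : n → ℝ) : ‖D * x‖₂ ≤ ‖D‖ * ‖x‖₂ := by
  classical
  rw [← Matrix.l2_opNorm_diagonal (n := n) (𝕜 := ℝ) D]
  exact (congrArg l2Norm (funext fun i => by simp [mulVec_diagonal])).trans_le
    (l2Norm_mulVec_le (diagonal D) x)

theorem abs_dotProduct_mul_le (D x y : n → ℝ) : |x ⬝ᵥ (D * y)| ≤ ‖D‖ * ‖x‖₂ * ‖y‖₂ :=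
  calc |x ⬝ᵥ (D * y)| ≤ ‖x‖₂ * ‖D * y‖₂ := abs_dotProduct_le _ _
    _ ≤ ‖x‖₂ * (‖D‖ * ‖y‖₂) := by gcongr; exacts [l2Norm_nonneg x, l2Norm_mul_le D y]
    _ = ‖D‖ * ‖x‖₂ * ‖y‖₂ := by ring

theorem abs_dotProduct_mulVec_le [DecidableEq n] (A : Matrix m n ℝ) (x : m → ℝ) (y : n → ℝ) :
    |x ⬝ᵥ A *ᵥ y| ≤ ‖A‖ * ‖x‖₂ * ‖y‖₂ :=
  calc |x ⬝ᵥ A *ᵥ y| ≤ ‖x‖₂ * ‖A *ᵥ y‖₂ := abs_dotProduct_le _ _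
    _ ≤ ‖x‖₂ * (‖A‖ * ‖y‖₂) := by gcongr; exacts [l2Norm_nonneg x, l2Norm_mulVec_le A y]
    _ = ‖A‖ * ‖x‖₂ * ‖y‖₂ := by ring

theorem mul_l2Norm_sq_le_dotProduct_mul {D : n → ℝ} {d : ℝ} (hD : ∀ i, d ≤ D i) (x : n → ℝ) :
    d * ‖x‖₂ ^ 2 ≤ x ⬝ᵥ (D * x) := by
  rw [l2Norm_sq, dotProduct, dotProduct, Finset.mul_sum]
  refine Finset.sum_le_sum fun i _ => ?_
  rw [Pi.mul_apply, mul_left_comm (x i)]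
  exact mul_le_mul_of_nonneg_right (hD i) (mul_self_nonneg _)

theorem norm_sq_le_l2Norm_sq (x : n → ℝ) : ‖x‖ ^ 2 ≤ ‖x‖₂ ^ 2 := by
  gcongr
  exact (pi_norm_le_iff_of_nonneg (l2Norm_nonneg x)).2 fun i =>
    PiLp.norm_apply_le (WithLp.toLp 2 x : EuclideanSpace ℝ n) i

theorem l2Norm_sq_le_card_mul (x : n → ℝ) : ‖x‖₂ ^ 2 ≤ Fintype.card n * ‖x‖ ^ 2 := by
  calc ‖x‖₂ ^ 2 = ∑ i, ‖x i‖ ^ 2 := by rw [l2Norm_sq]; simp [dotProduct, sq]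
    _ ≤ ∑ _i : n, ‖x‖ ^ 2 := Finset.sum_le_sum fun i _ => by gcongr; exact norm_le_pi_norm x i
    _ = Fintype.card n * ‖x‖ ^ 2 := by simp

theorem hasDerivAt_dotProduct {x y : ℝ → n → ℝ} {x' y' : n → ℝ} {t : ℝ} (hx : HasDerivAt x x' t)
    (hy : HasDerivAt y y' t) :
    HasDerivAt (fun s => x s ⬝ᵥ y s) (x' ⬝ᵥ y t + x t ⬝ᵥ y') t := by
  simp only [dotProduct, ← Finset.sum_add_distrib]
  exact HasDerivAt.fun_sum fun i _ => (hasDerivAt_pi.1 hx i).mul (hasDerivAt_pi.1 hy i)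

theorem norm_sq_le_sum_l2Norm_sq (z : (n → ℝ) × (n → ℝ) × (m → ℝ)) :
    ‖z‖ ^ 2 ≤ ‖z.1‖₂ ^ 2 + ‖z.2.1‖₂ ^ 2 + ‖z.2.2‖₂ ^ 2 := by
  have h₁ := sq_nonneg ‖z.1‖₂
  have h₂ := sq_nonneg ‖z.2.1‖₂
  have h₃ := sq_nonneg ‖z.2.2‖₂
  rw [← Real.le_sqrt (norm_nonneg z) (by positivity), norm_prod_le_iff, norm_prod_le_iff]
  refine ⟨Real.le_sqrt_of_sq_le ?_, Real.le_sqrt_of_sq_le ?_, Real.le_sqrt_of_sq_le ?_⟩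
  · linarith [norm_sq_le_l2Norm_sq z.1]
  · linarith [norm_sq_le_l2Norm_sq z.2.1]
  · linarith [norm_sq_le_l2Norm_sq z.2.2]

theorem sum_l2Norm_sq_le (z : (n → ℝ) × (n → ℝ) × (m → ℝ)) :
    ‖z.1‖₂ ^ 2 + ‖z.2.1‖₂ ^ 2 + ‖z.2.2‖₂ ^ 2 ≤
      (2 * Fintype.card n + Fintype.card m) * ‖z‖ ^ 2 := by
  have h₁ : ‖z.1‖ ≤ ‖z‖ := norm_fst_le z
  have h₂ : ‖z.2.1‖ ≤ ‖z‖ := (norm_fst_le z.2).trans (norm_snd_le z)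
  have h₃ : ‖z.2.2‖ ≤ ‖z‖ := (norm_snd_le z.2).trans (norm_snd_le z)
  calc ‖z.1‖₂ ^ 2 + ‖z.2.1‖₂ ^ 2 + ‖z.2.2‖₂ ^ 2
      ≤ Fintype.card n * ‖z.1‖ ^ 2 + Fintype.card n * ‖z.2.1‖ ^ 2 +
          Fintype.card m * ‖z.2.2‖ ^ 2 := by gcongr <;> exact l2Norm_sq_le_card_mul _
    _ ≤ Fintype.card n * ‖z‖ ^ 2 + Fintype.card n * ‖z‖ ^ 2 + Fintype.card m * ‖z‖ ^ 2 := by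
        gcongr
    _ = _ := by ring

end EuclideanLength

theorem eventually_mul_le (a : ℝ) {b : ℝ} (hb : 0 < b) : ∀ᶠ ε in 𝓝[>] (0 : ℝ), ε * a ≤ b := by
  have hlim : Tendsto (fun ε : ℝ => ε * a) (𝓝[>] 0) (𝓝 0) :=
    tendsto_nhdsWithin_of_tendsto_nhds (by simpa using (continuous_mul_const a).tendsto 0)
  exact (hlim.eventually_lt_const hb).mono fun _ => le_of_lt

theorem exists_pos_forall_le {ι : Type*} [Finite ι] {x : ι → ℝ} (hx : ∀ i, 0 < x i) :
    ∃ a > 0, ∀ i, a ≤ x i := by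
  cases isEmpty_or_nonempty ι
  · exact ⟨1, one_pos, isEmptyElim⟩
  · obtain ⟨i, hi⟩ := Finite.exists_min x
    exact ⟨x i, hx i, hi⟩

section Energy

variable {n m ι : Type*} [Fintype n] [Fintype m]

/-- Frequency dynamics with inertias `M`, damping `D` and restoring force `g`, coupled through `B`
to a controller with feedback `L` acting on the delayed control `q`. -/
noncomputable def delayField (M D : n → ℝ) (B : Matrix n m ℝ) (g : (n → ℝ) → n → ℝ)
    (L : Matrix m m ℝ) (z : (n → ℝ) × (n → ℝ) × (m → ℝ)) (q : m → ℝ) :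
    (n → ℝ) × (n → ℝ) × (m → ℝ) :=
  (z.2.1, M⁻¹ * (-(D * z.2.1) - g z.1 - B *ᵥ z.2.2), Bᵀ *ᵥ z.2.1 - L *ᵥ q)

/-- The control component of a state, with the Euclidean norm in which the delay is measured. -/
noncomputable def controlCLM : (n → ℝ) × (n → ℝ) × (m → ℝ) →L[ℝ] EuclideanSpace ℝ m :=
  (EuclideanSpace.equiv m ℝ).symm.toContinuousLinearMap ∘L
    ContinuousLinearMap.snd ℝ (n → ℝ) (m → ℝ) ∘L
      ContinuousLinearMap.snd ℝ (n → ℝ) ((n → ℝ) × (m → ℝ))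

/-- `P` is a potential with gradient `g`, strongly convex near its minimum `0`. -/
structure LocalPotential (P : (n → ℝ) → ℝ) (g : (n → ℝ) → n → ℝ) (r c C : ℝ) : Prop where
  radius_pos : 0 < r
  convexity_pos : 0 < c
  contDiff : ContDiff ℝ 1 P
  fderiv_eq : ∀ θ v, fderiv ℝ P θ v = g θ ⬝ᵥ v
  lower : ∀ θ, ‖θ‖ ≤ r → c * ‖θ‖₂ ^ 2 ≤ P θ
  upper : ∀ θ, ‖θ‖ ≤ r → P θ ≤ C * ‖θ‖₂ ^ 2
  monotone : ∀ θ, ‖θ‖ ≤ r → c * ‖θ‖₂ ^ 2 ≤ g θ ⬝ᵥ θ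

/-- Potential and kinetic energy plus the squared control, with a cross term of weight `ε` that
makes the energy decay in the angles too. -/
noncomputable def energy (P : (n → ℝ) → ℝ) (M : n → ℝ) (ε : ℝ)
    (z : (n → ℝ) × (n → ℝ) × (m → ℝ)) : ℝ :=
  P z.1 + (1 / 2) * (z.2.1 ⬝ᵥ (M * z.2.1)) + (1 / 2) * (z.2.2 ⬝ᵥ z.2.2) + ε * (z.1 ⬝ᵥ (M * z.2.1))

variable {P : (n → ℝ) → ℝ} {g : (n → ℝ) → n → ℝ} {r c C ε : ℝ} {M D : n → ℝ} {B : Matrix n m ℝ}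

theorem contDiff_energy (hP : ContDiff ℝ 1 P) (M : n → ℝ) (ε : ℝ) :
    ContDiff ℝ 1 (energy (m := m) P M ε) := by
  unfold energy
  simp only [dotProduct, Pi.mul_apply]
  fun_prop

theorem dotProduct_mul_comm (M x y : n → ℝ) : x ⬝ᵥ (M * y) = y ⬝ᵥ (M * x) := by
  simp only [dotProduct, Pi.mul_apply]
  exact Finset.sum_congr rfl fun i _ => by ring

theorem LocalPotential.fderiv_energy (hP : LocalPotential P g r c C) (M : n → ℝ) (ε : ℝ)
    (z v : (n → ℝ) × (n → ℝ) × (m → ℝ)) :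
    fderiv ℝ (energy P M ε) z v = g z.1 ⬝ᵥ v.1 + z.2.1 ⬝ᵥ (M * v.2.1) + z.2.2 ⬝ᵥ v.2.2 +
      ε * (v.1 ⬝ᵥ (M * z.2.1) + z.1 ⬝ᵥ (M * v.2.1)) := by
  have hline : HasDerivAt (fun s : ℝ => z + s • v) v 0 := by
    simpa using ((hasDerivAt_id (0 : ℝ)).smul_const v).const_add z
  have hθ : HasDerivAt (fun s : ℝ => (z + s • v).1) v.1 0 := hline.fst
  have hω : HasDerivAt (fun s : ℝ => (z + s • v).2.1) v.2.1 0 := hline.snd.fst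
  have hp : HasDerivAt (fun s : ℝ => (z + s • v).2.2) v.2.2 0 := hline.snd.snd
  have hMω := hω.const_mul M
  have hPθ := (hP.contDiff.differentiable one_ne_zero _).hasFDerivAt.comp_hasDerivAt 0 hθ
  have henergy := ((contDiff_energy (m := m) hP.contDiff M ε).differentiable one_ne_zero
    _).hasFDerivAt.comp_hasDerivAt 0 hline
  have hsum := ((hPθ.add ((hasDerivAt_dotProduct hω hMω).const_mul (1 / 2))).add
    ((hasDerivAt_dotProduct hp hp).const_mul (1 / 2))).add
      ((hasDerivAt_dotProduct hθ hMω).const_mul ε)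
  have huniq := henergy.unique hsum
  simp only [zero_smul, add_zero, hP.fderiv_eq] at huniq
  rw [huniq, dotProduct_mul_comm M v.2.1, dotProduct_comm v.2.2]
  ring

theorem mul_delayField_frequency (hM : ∀ i, M i ≠ 0) (D : n → ℝ) (B : Matrix n m ℝ)
    (g : (n → ℝ) → n → ℝ) (L : Matrix m m ℝ) (z : (n → ℝ) × (n → ℝ) × (m → ℝ)) (q : m → ℝ) :
    M * (delayField M D B g L z q).2.1 = -(D * z.2.1) - g z.1 - B *ᵥ z.2.2 :=
  funext fun i => mul_inv_cancel_left₀ (hM i) _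

theorem LocalPotential.fderiv_energy_delayField (hP : LocalPotential P g r c C)
    (hM : ∀ i, M i ≠ 0) (D : n → ℝ) (B : Matrix n m ℝ) (L : Matrix m m ℝ) (ε : ℝ)
    (z : (n → ℝ) × (n → ℝ) × (m → ℝ)) (q : m → ℝ) :
    fderiv ℝ (energy P M ε) z (delayField M D B g L z q) =
      -(z.2.1 ⬝ᵥ (D * z.2.1)) - z.2.2 ⬝ᵥ L *ᵥ z.2.2 + z.2.2 ⬝ᵥ L *ᵥ (z.2.2 - q) +
        ε * (z.2.1 ⬝ᵥ (M * z.2.1) - z.1 ⬝ᵥ (D * z.2.1) - g z.1 ⬝ᵥ z.1 - z.1 ⬝ᵥ B *ᵥ z.2.2) := by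
  have hcoupling : z.2.2 ⬝ᵥ Bᵀ *ᵥ z.2.1 = z.2.1 ⬝ᵥ B *ᵥ z.2.2 := by
    rw [dotProduct_mulVec, vecMul_transpose, dotProduct_comm]
  rw [hP.fderiv_energy, mul_delayField_frequency hM]
  simp only [delayField, dotProduct_sub, dotProduct_neg, mulVec_sub, hcoupling,
    dotProduct_comm _ (g z.1)]
  ring

theorem mul_le_mul_sq_add_sq_div {u : ℝ} (hu : 0 < u) (x y : ℝ) :
    x * y ≤ u * x ^ 2 + y ^ 2 / (4 * u) := by
  have hsq : u * x ^ 2 + y ^ 2 / (4 * u) - x * y = (2 * u * x - y) ^ 2 / (4 * u) := by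
    field_simp
    ring
  linarith [(by positivity : 0 ≤ (2 * u * x - y) ^ 2 / (4 * u))]

section Dissipation

variable [DecidableEq m] {L : Matrix m m ℝ} {l lam γ h : ℝ}

theorem l2Norm_control_velocity_sq_le (hL : ‖L‖ ≤ l) (ω : n → ℝ) (p q : m → ℝ) :
    ‖Bᵀ *ᵥ ω - L *ᵥ q‖₂ ^ 2 ≤
      2 * ‖B‖ ^ 2 * ‖ω‖₂ ^ 2 + 4 * l ^ 2 * ‖p‖₂ ^ 2 + 4 * l ^ 2 * ‖p - q‖₂ ^ 2 := by
  classical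
  have hB : ‖Bᵀ *ᵥ ω‖₂ ≤ ‖B‖ * ‖ω‖₂ := by
    rw [← Matrix.l2_opNorm_conjTranspose, conjTranspose_eq_transpose_of_trivial]
    exact l2Norm_mulVec_le Bᵀ ω
  have hl : 0 ≤ l := (norm_nonneg L).trans hL
  have hq : ‖q‖₂ ≤ ‖p‖₂ + ‖p - q‖₂ := by simpa using l2Norm_sub_le p (p - q)
  have hLq : ‖L *ᵥ q‖₂ ≤ l * (‖p‖₂ + ‖p - q‖₂) :=
    (l2Norm_mulVec_le L q).trans (mul_le_mul hL hq (l2Norm_nonneg q) hl)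
  calc ‖Bᵀ *ᵥ ω - L *ᵥ q‖₂ ^ 2
      ≤ (‖B‖ * ‖ω‖₂ + l * (‖p‖₂ + ‖p - q‖₂)) ^ 2 := by
        have := l2Norm_nonneg (Bᵀ *ᵥ ω - L *ᵥ q)
        gcongr
        exact (l2Norm_sub_le _ _).trans (add_le_add hB hLq)
    _ ≤ 2 * ((‖B‖ * ‖ω‖₂) ^ 2 + (l * (‖p‖₂ + ‖p - q‖₂)) ^ 2) := add_sq_le
    _ ≤ 2 * ((‖B‖ * ‖ω‖₂) ^ 2 + l ^ 2 * (2 * (‖p‖₂ ^ 2 + ‖p - q‖₂ ^ 2))) := by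
        rw [mul_pow l]
        gcongr
        exact add_sq_le
    _ = _ := by ring

theorem control_dissipation_le (hlam : 0 < lam) (hL : ‖L‖ ≤ l)
    (hcoercive : ∀ x, lam * ‖x‖₂ ^ 2 ≤ x ⬝ᵥ L *ᵥ x) (hγh : 0 ≤ γ * h) (ω : n → ℝ) (p q : m → ℝ) :
    -(p ⬝ᵥ L *ᵥ p) + p ⬝ᵥ L *ᵥ (p - q) + γ * h * ‖Bᵀ *ᵥ ω - L *ᵥ q‖₂ ^ 2 ≤
      2 * γ * h * ‖B‖ ^ 2 * ‖ω‖₂ ^ 2 + (4 * γ * h * l ^ 2 - lam / 2) * ‖p‖₂ ^ 2 +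
        (l ^ 2 / (2 * lam) + 4 * γ * h * l ^ 2) * ‖p - q‖₂ ^ 2 := by
  have hmismatch : p ⬝ᵥ L *ᵥ (p - q) ≤ lam / 2 * ‖p‖₂ ^ 2 + l ^ 2 / (2 * lam) * ‖p - q‖₂ ^ 2 :=
    calc p ⬝ᵥ L *ᵥ (p - q) ≤ ‖L‖ * ‖p‖₂ * ‖p - q‖₂ := le_of_abs_le (abs_dotProduct_mulVec_le _ _ _)
      _ ≤ l * ‖p‖₂ * ‖p - q‖₂ := by gcongr <;> exact l2Norm_nonneg _
      _ = ‖p‖₂ * (l * ‖p - q‖₂) := by ring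
      _ ≤ _ := mul_le_mul_sq_add_sq_div (half_pos hlam) _ _
      _ = _ := by ring
  have hvelocity := mul_le_mul_of_nonneg_left
    (l2Norm_control_velocity_sq_le (B := B) hL ω p q) hγh
  linarith [hcoercive p]

theorem cross_dissipation_le (hc : 0 < c) {θ ω G : n → ℝ} (hG : c * ‖θ‖₂ ^ 2 ≤ G ⬝ᵥ θ)
    (M D : n → ℝ) (B : Matrix n m ℝ) (p : m → ℝ) :
    ω ⬝ᵥ (M * ω) - θ ⬝ᵥ (D * ω) - G ⬝ᵥ θ - θ ⬝ᵥ B *ᵥ p ≤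
      (‖M‖ + ‖D‖ ^ 2 / c) * ‖ω‖₂ ^ 2 + ‖B‖ ^ 2 / c * ‖p‖₂ ^ 2 - c / 2 * ‖θ‖₂ ^ 2 := by
  have hinertia : ω ⬝ᵥ (M * ω) ≤ ‖M‖ * ‖ω‖₂ ^ 2 :=
    (le_of_abs_le (abs_dotProduct_mul_le M ω ω)).trans_eq (by ring)
  have hdamping : -(θ ⬝ᵥ (D * ω)) ≤ c / 4 * ‖θ‖₂ ^ 2 + ‖D‖ ^ 2 / c * ‖ω‖₂ ^ 2 :=
    calc -(θ ⬝ᵥ (D * ω)) ≤ ‖D‖ * ‖θ‖₂ * ‖ω‖₂ :=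
          (neg_le_abs _).trans (abs_dotProduct_mul_le D θ ω)
      _ = ‖θ‖₂ * (‖D‖ * ‖ω‖₂) := by ring
      _ ≤ _ := mul_le_mul_sq_add_sq_div (by positivity : 0 < c / 4) _ _
      _ = _ := by ring
  have hinput : -(θ ⬝ᵥ B *ᵥ p) ≤ c / 4 * ‖θ‖₂ ^ 2 + ‖B‖ ^ 2 / c * ‖p‖₂ ^ 2 :=
    calc -(θ ⬝ᵥ B *ᵥ p) ≤ ‖B‖ * ‖θ‖₂ * ‖p‖₂ :=
          (neg_le_abs _).trans (abs_dotProduct_mulVec_le B θ p)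
      _ = ‖θ‖₂ * (‖B‖ * ‖p‖₂) := by ring
      _ ≤ _ := mul_le_mul_sq_add_sq_div (by positivity : 0 < c / 4) _ _
      _ = _ := by ring
  linarith

end Dissipation

section EnergyBounds

variable {m₀ : ℝ}

theorem abs_mul_dotProduct_mul_le (hε : 0 ≤ ε) (M x y : n → ℝ) :
    |ε * (x ⬝ᵥ (M * y))| ≤ ε * ‖M‖ / 2 * (‖x‖₂ ^ 2 + ‖y‖₂ ^ 2) :=
  calc |ε * (x ⬝ᵥ (M * y))| = ε * |x ⬝ᵥ (M * y)| := by rw [abs_mul, abs_of_nonneg hε]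
    _ ≤ ε * (‖M‖ * ‖x‖₂ * ‖y‖₂) := by gcongr; exact abs_dotProduct_mul_le M x y
    _ = ε * ‖M‖ / 2 * (2 * ‖x‖₂ * ‖y‖₂) := by ring
    _ ≤ ε * ‖M‖ / 2 * (‖x‖₂ ^ 2 + ‖y‖₂ ^ 2) := by gcongr; exact two_mul_le_add_sq _ _

theorem LocalPotential.le_energy (hP : LocalPotential P g r c C) (hε : 0 ≤ ε)
    (hεc : ε * ‖M‖ ≤ c) (hεm : ε * ‖M‖ ≤ m₀ / 2) (hM : ∀ i, m₀ ≤ M i)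
    {z : (n → ℝ) × (n → ℝ) × (m → ℝ)} (hz : ‖z.1‖ ≤ r) :
    c / 2 * ‖z.1‖₂ ^ 2 + m₀ / 4 * ‖z.2.1‖₂ ^ 2 + 1 / 2 * ‖z.2.2‖₂ ^ 2 ≤ energy P M ε z := by
  have hcross := neg_le_of_abs_le (abs_mul_dotProduct_mul_le hε M z.1 z.2.1)
  have hθ := mul_le_mul_of_nonneg_right hεc (sq_nonneg ‖z.1‖₂)
  have hω := mul_le_mul_of_nonneg_right hεm (sq_nonneg ‖z.2.1‖₂)
  rw [energy, ← l2Norm_sq]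
  linarith [hP.lower _ hz, mul_l2Norm_sq_le_dotProduct_mul hM z.2.1]

theorem LocalPotential.energy_le (hP : LocalPotential P g r c C) (hε : 0 ≤ ε)
    (hεc : ε * ‖M‖ ≤ c) (hεm : ε * ‖M‖ ≤ m₀ / 2)
    {z : (n → ℝ) × (n → ℝ) × (m → ℝ)} (hz : ‖z.1‖ ≤ r) :
    energy P M ε z ≤ (C + c / 2) * ‖z.1‖₂ ^ 2 + (‖M‖ + m₀ / 4) * ‖z.2.1‖₂ ^ 2 + ‖z.2.2‖₂ ^ 2 := by
  have hcross := le_of_abs_le (abs_mul_dotProduct_mul_le hε M z.1 z.2.1)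
  have hθ := mul_le_mul_of_nonneg_right hεc (sq_nonneg ‖z.1‖₂)
  have hω := mul_le_mul_of_nonneg_right hεm (sq_nonneg ‖z.2.1‖₂)
  have hM := mul_nonneg (norm_nonneg M) (sq_nonneg ‖z.2.1‖₂)
  rw [energy, ← l2Norm_sq]
  linarith [hP.upper _ hz, le_of_abs_le (abs_dotProduct_mul_le M z.2.1 z.2.1),
    sq_nonneg ‖z.2.2‖₂]

end EnergyBounds

section SmallGain

theorem mul_norm_sq_le_of_le {a b c e : ℝ} (ha : e ≤ a) (hb : e ≤ b) (hc : e ≤ c) (he : 0 ≤ e)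
    (z : (n → ℝ) × (n → ℝ) × (m → ℝ)) :
    e * ‖z‖ ^ 2 ≤ a * ‖z.1‖₂ ^ 2 + b * ‖z.2.1‖₂ ^ 2 + c * ‖z.2.2‖₂ ^ 2 :=
  calc e * ‖z‖ ^ 2 ≤ e * (‖z.1‖₂ ^ 2 + ‖z.2.1‖₂ ^ 2 + ‖z.2.2‖₂ ^ 2) := by
        gcongr
        exact norm_sq_le_sum_l2Norm_sq z
    _ = e * ‖z.1‖₂ ^ 2 + e * ‖z.2.1‖₂ ^ 2 + e * ‖z.2.2‖₂ ^ 2 := by ring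
    _ ≤ _ := by gcongr

theorem exists_mul_norm_sq_ge (a b c : ℝ) :
    ∃ e > 0, ∀ z : (n → ℝ) × (n → ℝ) × (m → ℝ),
      a * ‖z.1‖₂ ^ 2 + b * ‖z.2.1‖₂ ^ 2 + c * ‖z.2.2‖₂ ^ 2 ≤ e * ‖z‖ ^ 2 := by
  refine ⟨(|a| + |b| + |c|) * (2 * Fintype.card n + Fintype.card m) + 1, by positivity,
    fun z => ?_⟩
  have ha : |a| ≤ |a| + |b| + |c| := by linarith [abs_nonneg b, abs_nonneg c]
  have hb : |b| ≤ |a| + |b| + |c| := by linarith [abs_nonneg a, abs_nonneg c]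
  have hc : |c| ≤ |a| + |b| + |c| := by linarith [abs_nonneg a, abs_nonneg b]
  calc a * ‖z.1‖₂ ^ 2 + b * ‖z.2.1‖₂ ^ 2 + c * ‖z.2.2‖₂ ^ 2
      ≤ (|a| + |b| + |c|) * ‖z.1‖₂ ^ 2 + (|a| + |b| + |c|) * ‖z.2.1‖₂ ^ 2 +
          (|a| + |b| + |c|) * ‖z.2.2‖₂ ^ 2 := by
        gcongr
        exacts [(le_abs_self a).trans ha, (le_abs_self b).trans hb, (le_abs_self c).trans hc]
    _ = (|a| + |b| + |c|) * (‖z.1‖₂ ^ 2 + ‖z.2.1‖₂ ^ 2 + ‖z.2.2‖₂ ^ 2) := by ring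
    _ ≤ (|a| + |b| + |c|) * ((2 * Fintype.card n + Fintype.card m) * ‖z‖ ^ 2) := by
        gcongr
        exact sum_l2Norm_sq_le z
    _ ≤ _ := by linarith [sq_nonneg ‖z‖]

variable [DecidableEq m] {L : ι → Matrix m m ℝ} {h d l lam γ : ℝ}

/-- Gain bounds under which the delayed feedback does not destroy stability, for delays up to `h`;
`γ` is the weight of the delay memory in the Lyapunov–Krasovskii functional. -/
structure GainBounds (D : n → ℝ) (B : Matrix n m ℝ) (L : ι → Matrix m m ℝ) (h d l lam γ : ℝ) :
    Prop where
  delay_nonneg : 0 ≤ h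
  damping_pos : 0 < d
  coercivity_pos : 0 < lam
  memory_pos : 0 < γ
  damping : ∀ i, d ≤ D i
  feedback : ∀ ℓ, ‖L ℓ‖ ≤ l
  coercive : ∀ ℓ x, lam * ‖x‖₂ ^ 2 ≤ x ⬝ᵥ L ℓ *ᵥ x
  damping_dominates : 2 * γ * h * ‖B‖ ^ 2 ≤ d / 2
  coercive_dominates : 4 * γ * h * l ^ 2 ≤ lam / 4
  memory_dominates : 2 * h * (l ^ 2 / (2 * lam) + 4 * γ * h * l ^ 2) < γ

theorem LocalPotential.energy_dissipation (hP : LocalPotential P g r c C)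
    (hB : GainBounds D B L h d l lam γ) (hM : ∀ i, M i ≠ 0) (hε : 0 ≤ ε)
    (hεd : ε * (‖M‖ + ‖D‖ ^ 2 / c) ≤ d / 4) (hεl : ε * (‖B‖ ^ 2 / c) ≤ lam / 8) (ℓ : ι)
    {z : (n → ℝ) × (n → ℝ) × (m → ℝ)} (hz : ‖z.1‖ ≤ r) (q : m → ℝ) :
    fderiv ℝ (energy P M ε) z (delayField M D B g (L ℓ) z q) +
        γ * h * ‖(delayField M D B g (L ℓ) z q).2.2‖₂ ^ 2 ≤
      -(ε * c / 2 * ‖z.1‖₂ ^ 2 + d / 4 * ‖z.2.1‖₂ ^ 2 + lam / 8 * ‖z.2.2‖₂ ^ 2) +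
        (l ^ 2 / (2 * lam) + 4 * γ * h * l ^ 2) * ‖z.2.2 - q‖₂ ^ 2 := by
  have hcontrol := control_dissipation_le (B := B) hB.coercivity_pos (hB.feedback ℓ)
    (hB.coercive ℓ) (mul_nonneg hB.memory_pos.le hB.delay_nonneg) z.2.1 z.2.2 q
  have hcross := mul_le_mul_of_nonneg_left
    (cross_dissipation_le hP.convexity_pos (hP.monotone _ hz) M D B z.2.2 (ω := z.2.1)) hε
  have hd := mul_le_mul_of_nonneg_right hB.damping_dominates (sq_nonneg ‖z.2.1‖₂)
  have hl := mul_le_mul_of_nonneg_right hB.coercive_dominates (sq_nonneg ‖z.2.2‖₂)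
  have hεd' := mul_le_mul_of_nonneg_right hεd (sq_nonneg ‖z.2.1‖₂)
  have hεl' := mul_le_mul_of_nonneg_right hεl (sq_nonneg ‖z.2.2‖₂)
  rw [hP.fderiv_energy_delayField hM]
  simp only [delayField]
  linarith [mul_l2Norm_sq_le_dotProduct_mul hB.damping z.2.1]

theorem LocalPotential.exists_isDelayLyapunov (hP : LocalPotential P g r c C)
    (hB : GainBounds D B L h d l lam γ) (hM : ∀ i, 0 < M i) :
    ∃ ε c₁ c₂ α, IsDelayLyapunov
      (fun ℓ (z y : (n → ℝ) × (n → ℝ) × (m → ℝ)) => delayField M D B g (L ℓ) z y.2.2) controlCLM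
      (energy P M ε) h r c₁ c₂ α γ (l ^ 2 / (2 * lam) + 4 * γ * h * l ^ 2) := by
  have hc := hP.convexity_pos
  have hd := hB.damping_pos
  have hlam := hB.coercivity_pos
  have hh := hB.delay_nonneg
  have hγ := hB.memory_pos
  obtain ⟨m₀, hm₀, hMm₀⟩ := exists_pos_forall_le hM
  obtain ⟨ε, hε, hεc, hεm, hεd, hεl⟩ := (eventually_mem_nhdsWithin.and <|
    (eventually_mul_le ‖M‖ hc).and <| (eventually_mul_le ‖M‖ (half_pos hm₀)).and <|
      (eventually_mul_le (‖M‖ + ‖D‖ ^ 2 / c) (by positivity : 0 < d / 4)).and <|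
        eventually_mul_le (‖B‖ ^ 2 / c) (by positivity : 0 < lam / 8)).exists
  have hε : 0 < ε := hε
  obtain ⟨c₂, hc₂, hupper⟩ := exists_mul_norm_sq_ge (n := n) (m := m) (C + c / 2) (‖M‖ + m₀ / 4) 1
  refine ⟨ε, min (c / 2) (min (m₀ / 4) (1 / 2)), c₂, min (ε * c / 2) (min (d / 4) (lam / 8)), ?_⟩
  have hθ : ∀ z : (n → ℝ) × (n → ℝ) × (m → ℝ), ‖z‖ ≤ r → ‖z.1‖ ≤ r := fun z => (norm_fst_le z).trans
  exact
    { contDiff := contDiff_energy hP.contDiff M ε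
      radius_pos := hP.radius_pos
      lower_pos := by positivity
      upper_pos := hc₂
      rate_pos := by positivity
      mismatch_nonneg := by positivity
      small_delay := hB.memory_dominates
      lower := fun z hz => (mul_norm_sq_le_of_le (by simp) (by simp) (by simp) (by positivity)
        z).trans (hP.le_energy hε.le hεc hεm hMm₀ (hθ z hz))
      upper := fun z hz => (hP.energy_le hε.le hεc hεm (hθ z hz)).trans (by simpa using hupper z)
      dissipation := fun ℓ z y hz => by
        refine (hP.energy_dissipation hB (fun i => (hM i).ne') hε.le hεd hεl ℓ (hθ z hz)
          y.2.2).trans (add_le_add_left ?_ _)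
        rw [neg_mul]
        exact neg_le_neg (mul_norm_sq_le_of_le (by simp) (by simp) (by simp) (by positivity) z) }

theorem LocalPotential.isLUES_delayField [Finite ι] (hP : LocalPotential P g r c C)
    (hB : GainBounds D B L h d l lam γ) (hM : ∀ i, 0 < M i) (hg : Continuous g) (hg₀ : g 0 = 0) :
    IsLUES h (IsDelaySolution
      (fun ℓ (z y : (n → ℝ) × (n → ℝ) × (m → ℝ)) => delayField M D B g (L ℓ) z y.2.2) h) := by
  obtain ⟨ε, c₁, c₂, α, hV⟩ := hP.exists_isDelayLyapunov hB hM
  refine hV.isLUES hB.delay_nonneg (fun ℓ => ?_) fun ℓ => ?_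
  · unfold delayField
    fun_prop
  · simp [delayField, hg₀]

end SmallGain

end Energy

section Homogeneous

variable {E : Type*} [NormedAddCommGroup E] [NormedSpace ℝ E] {Q : E → ℝ}

theorem eq_norm_sq_mul_of_homogeneous (hhom : ∀ (t : ℝ) x, Q (t • x) = t ^ 2 * Q x) (x : E) :
    Q x = ‖x‖ ^ 2 * Q (‖x‖⁻¹ • x) := by
  rw [← hhom]
  rcases eq_or_ne x 0 with rfl | hx
  · simp
  · rw [smul_inv_smul₀ (norm_ne_zero_iff.2 hx)]

variable [ProperSpace E]

theorem exists_pos_mul_norm_sq_le_of_homogeneous (hQ : Continuous Q)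
    (hhom : ∀ (t : ℝ) x, Q (t • x) = t ^ 2 * Q x) (hpos : ∀ x, x ≠ 0 → 0 < Q x) :
    ∃ c > 0, ∀ x, c * ‖x‖ ^ 2 ≤ Q x := by
  obtain ⟨c, hc, hsphere⟩ : ∃ c > 0, ∀ x ∈ Metric.sphere (0 : E) 1, c ≤ Q x :=
    (isCompact_sphere 0 1).exists_forall_le' hQ.continuousOn
      fun x hx => hpos x (ne_zero_of_mem_unit_sphere ⟨x, hx⟩)
  refine ⟨c, hc, fun x => ?_⟩
  rcases eq_or_ne x 0 with rfl | hx
  · rw [eq_norm_sq_mul_of_homogeneous hhom]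
    simp
  · rw [eq_norm_sq_mul_of_homogeneous hhom, mul_comm]
    gcongr
    exact hsphere _ (by simp [norm_smul, hx])

theorem exists_le_mul_norm_sq_of_homogeneous (hQ : Continuous Q)
    (hhom : ∀ (t : ℝ) x, Q (t • x) = t ^ 2 * Q x) : ∃ C, ∀ x, Q x ≤ C * ‖x‖ ^ 2 := by
  obtain ⟨C, hC⟩ := (isCompact_closedBall (0 : E) 1).exists_bound_of_continuousOn hQ.continuousOn
  refine ⟨C, fun x => ?_⟩
  have hball : ‖x‖⁻¹ • x ∈ Metric.closedBall (0 : E) 1 := by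
    simpa [norm_smul] using inv_mul_le_one
  rw [eq_norm_sq_mul_of_homogeneous hhom, mul_comm]
  gcongr
  exact (le_abs_self _).trans (hC _ hball)

variable {n : Type*} [Fintype n] {F : (n → ℝ) → ℝ}

theorem exists_pos_mul_l2Norm_sq_le (hF : Continuous F)
    (hhom : ∀ (t : ℝ) x, F (t • x) = t ^ 2 * F x) (hpos : ∀ x, x ≠ 0 → 0 < F x) :
    ∃ c > 0, ∀ x, c * ‖x‖₂ ^ 2 ≤ F x := by
  obtain ⟨c, hc, hle⟩ := exists_pos_mul_norm_sq_le_of_homogeneous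
    (Q := fun x : EuclideanSpace ℝ n => F x.ofLp) (hF.comp (PiLp.continuous_ofLp 2 _))
    (fun t x => hhom t x.ofLp) fun x hx => hpos _ fun h => hx (by ext i; exact congrFun h i)
  exact ⟨c, hc, fun x => hle (WithLp.toLp 2 x)⟩

theorem exists_le_mul_l2Norm_sq (hF : Continuous F)
    (hhom : ∀ (t : ℝ) x, F (t • x) = t ^ 2 * F x) : ∃ C, ∀ x, F x ≤ C * ‖x‖₂ ^ 2 := by
  obtain ⟨C, hle⟩ := exists_le_mul_norm_sq_of_homogeneous
    (Q := fun x : EuclideanSpace ℝ n => F x.ofLp) (hF.comp (PiLp.continuous_ofLp 2 _))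
    fun t x => hhom t x.ofLp
  exact ⟨C, fun x => hle (WithLp.toLp 2 x)⟩

end Homogeneous

section Cosine

theorem tangent_le_of_convexOn {s : Set ℝ} {f : ℝ → ℝ} {f' x y : ℝ} (hf : ConvexOn ℝ s f)
    (hx : x ∈ s) (hy : y ∈ s) (hfx : HasDerivAt f f' x) : f x + f' * (y - x) ≤ f y := by
  rcases lt_trichotomy x y with hxy | rfl | hxy
  · have hslope := hf.le_slope_of_hasDerivAt hx hy hxy hfx
    rw [slope_def_field, le_div_iff₀ (sub_pos.2 hxy)] at hslope
    linarith
  · simp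
  · have hslope := hf.slope_le_of_hasDerivAt hy hx hxy hfx
    rw [slope_def_field, div_le_iff₀ (sub_pos.2 hxy)] at hslope
    linarith

theorem hasDerivAt_mul_sq_add_mul_cos (c e x : ℝ) :
    HasDerivAt (fun x => c / 2 * x ^ 2 + e * Real.cos x) (c * x - e * Real.sin x) x := by
  refine (((hasDerivAt_pow 2 x).const_mul (c / 2)).add
    ((Real.hasDerivAt_cos x).const_mul e)).congr_deriv ?_
  simp only [Nat.cast_ofNat, Nat.add_one_sub_one, pow_one]
  ring

theorem convexOn_mul_sq_add_mul_cos {s : Set ℝ} (hs : Convex ℝ s) {c e : ℝ}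
    (hce : ∀ x ∈ s, e * Real.cos x ≤ c) :
    ConvexOn ℝ s fun x => c / 2 * x ^ 2 + e * Real.cos x := by
  refine convexOn_of_hasDerivWithinAt2_nonneg hs (by fun_prop)
    (f' := fun x => c * x - e * Real.sin x) (f'' := fun x => c - e * Real.cos x)
    (fun x _ => (hasDerivAt_mul_sq_add_mul_cos c e x).hasDerivWithinAt) (fun x _ => ?_)
    fun x hx => sub_nonneg.2 (hce x (interior_subset hx))
  simpa using ((hasDerivAt_id x).const_mul c).fun_sub ((Real.hasDerivAt_sin x).const_mul e)
    |>.hasDerivWithinAt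

variable {a b e : ℝ}

theorem cos_sub_cos_sub_mul_sin_le (a e : ℝ) :
    Real.cos a - Real.cos (a + e) - e * Real.sin a ≤ 1 / 2 * e ^ 2 := by
  have htangent := tangent_le_of_convexOn (x := a) (y := a + e)
    (convexOn_mul_sq_add_mul_cos convex_univ (c := 1) (e := 1)
      fun x _ => by simpa using Real.cos_le_one x)
    (mem_univ _) (mem_univ _) (hasDerivAt_mul_sq_add_mul_cos 1 1 a)
  linarith

theorem le_cos_sub_cos_sub_mul_sin (hb : b ≤ Real.pi) (ha : |a| ≤ b) (hae : |a + e| ≤ b) :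
    Real.cos b / 2 * e ^ 2 ≤ Real.cos a - Real.cos (a + e) - e * Real.sin a := by
  have hcos : ∀ x ∈ Icc (-b) b, -1 * Real.cos x ≤ -Real.cos b := fun x hx => by
    rw [neg_one_mul, neg_le_neg_iff, ← Real.cos_abs x]
    exact Real.cos_le_cos_of_nonneg_of_le_pi (abs_nonneg x) hb (abs_le.2 hx)
  have htangent := tangent_le_of_convexOn (convexOn_mul_sq_add_mul_cos (convex_Icc (-b) b) hcos)
    (abs_le.1 ha) (abs_le.1 hae) (hasDerivAt_mul_sq_add_mul_cos _ _ a)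
  linarith

theorem cos_mul_sq_le_sin_sub_sin_mul (hb : b ≤ Real.pi) (ha : |a| ≤ b) (hae : |a + e| ≤ b) :
    Real.cos b * e ^ 2 ≤ (Real.sin (a + e) - Real.sin a) * e := by
  have hforward := le_cos_sub_cos_sub_mul_sin hb ha hae
  have hbackward := le_cos_sub_cos_sub_mul_sin hb hae (e := -e) (by simpa using ha)
  rw [add_neg_cancel_right] at hbackward
  linarith

end Cosine

section NetworkPotential

theorem sum_sum_ite_lt_of_symm {n : ℕ} {f : Fin n → Fin n → ℝ} (hsymm : ∀ i k, f i k = f k i)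
    (hdiag : ∀ i, f i i = 0) :
    (∑ i, ∑ k, if i < k then f i k else 0) = 1 / 2 * ∑ i, ∑ k, f i k := by
  have hsplit : ∀ i k, f i k = (if i < k then f i k else 0) + if k < i then f k i else 0 := by
    intro i k
    rcases lt_trichotomy i k with hik | rfl | hik
    · simp [hik, hik.not_gt]
    · simp [hdiag]
    · simp [hik, hik.not_gt, hsymm i k]
  have hswap : (∑ i, ∑ k, if k < i then f k i else 0) = ∑ i, ∑ k, if i < k then f i k else 0 :=
    Finset.sum_comm
  rw [Finset.sum_congr rfl fun i _ => Finset.sum_congr rfl fun k _ => hsplit i k]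
  simp only [Finset.sum_add_distrib, hswap]
  ring

theorem sum_sum_mul_of_antisymm {ι : Type*} [Fintype ι] {f : ι → ι → ℝ}
    (hanti : ∀ i k, f k i = -f i k) (v : ι → ℝ) :
    ∑ i, ∑ k, f i k * v i = 1 / 2 * ∑ i, ∑ k, f i k * (v i - v k) := by
  have hswap : ∑ i, ∑ k, f i k * v k = -∑ i, ∑ k, f i k * v i := by
    rw [Finset.sum_comm]
    simp only [← Finset.sum_neg_distrib]
    exact Finset.sum_congr rfl fun i _ => Finset.sum_congr rfl fun k _ => by rw [hanti, neg_mul]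
  simp only [mul_sub, Finset.sum_sub_distrib, hswap]
  ring

variable {n : ℕ} (N : PowerNetwork n)

namespace PowerNetwork

/-- Coupling strength of the line between nodes `i` and `k`. -/
noncomputable def weight (i k : Fin n) : ℝ := |N.B i k| * N.V i * N.V k

theorem weight_nonneg (i k : Fin n) : 0 ≤ N.weight i k :=
  mul_nonneg (mul_nonneg (abs_nonneg _) (N.V_pos i).le) (N.V_pos k).le

theorem weight_pos {i k : Fin n} (hB : N.B i k ≠ 0) : 0 < N.weight i k :=
  mul_pos (mul_pos (abs_pos.2 hB) (N.V_pos i)) (N.V_pos k)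

theorem weight_symm (i k : Fin n) : N.weight i k = N.weight k i := by
  rw [weight, weight, N.B_symm]
  ring

/-- Weighted sum over the lines of the network of a quantity `F i k = F k i` attached to the line
between `i` and `k`; the factor `1 / 2` compensates for listing each line twice. -/
noncomputable def lineSum (F : Fin n → Fin n → ℝ) : ℝ :=
  1 / 2 * ∑ i, ∑ k, N.weight i k * F i k

theorem lineSum_mono {F G : Fin n → Fin n → ℝ} (hFG : ∀ i k, N.B i k ≠ 0 → F i k ≤ G i k) :
    N.lineSum F ≤ N.lineSum G := by
  unfold lineSum
  gcongr 1 / 2 * ∑ i, ∑ k, ?_ with i _ k _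
  by_cases hB : N.B i k = 0
  · simp [weight, hB]
  · exact mul_le_mul_of_nonneg_left (hFG i k hB) (N.weight_nonneg i k)

theorem lineSum_const_mul (t : ℝ) (F : Fin n → Fin n → ℝ) :
    N.lineSum (fun i k => t * F i k) = t * N.lineSum F := by
  simp only [lineSum, mul_left_comm _ t, ← Finset.mul_sum]

theorem lineSum_sub (F G : Fin n → Fin n → ℝ) :
    N.lineSum (fun i k => F i k - G i k) = N.lineSum F - N.lineSum G := by
  simp only [lineSum, mul_sub, Finset.sum_sub_distrib]

theorem eq_of_lineSum_sq_eq_zero {θ : Fin n → ℝ}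
    (hθ : N.lineSum (fun i k => (θ i - θ k) ^ 2) = 0) (i k : Fin n) : θ i = θ k := by
  have hterm : ∀ i k, 0 ≤ N.weight i k * (θ i - θ k) ^ 2 := fun i k =>
    mul_nonneg (N.weight_nonneg i k) (sq_nonneg _)
  have hline : ∀ i k, N.B i k ≠ 0 → θ i = θ k := fun i k hB => by
    have hsum := (mul_eq_zero.1 hθ).resolve_left (by norm_num)
    rw [Finset.sum_eq_zero_iff_of_nonneg fun i _ => Finset.sum_nonneg fun k _ => hterm i k] at hsum
    have hik := (Finset.sum_eq_zero_iff_of_nonneg fun k _ => hterm i k).1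
      (hsum i (Finset.mem_univ i)) k (Finset.mem_univ k)
    exact sub_eq_zero.1 (pow_eq_zero_iff two_ne_zero |>.1
      ((mul_eq_zero.1 hik).resolve_left (N.weight_pos hB).ne'))
  obtain ⟨w⟩ := N.connected.preconnected i k
  induction w with
  | nil => rfl
  | cons hadj _ ih => exact (hadj.2.elim (hline _ _) fun hB => (hline _ _ hB).symm).trans ih

theorem potential_sub (θ θ' : Fin n → ℝ) :
    N.potential θ' - N.potential θ =
      N.lineSum fun i k => Real.cos (θ i - θ k) - Real.cos (θ' i - θ' k) := by
  have hcos : ∀ (ψ : Fin n → ℝ) i k, Real.cos (ψ i - ψ k) = Real.cos (ψ k - ψ i) := fun ψ i k => by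
    rw [← neg_sub, Real.cos_neg]
  rw [lineSum, ← sum_sum_ite_lt_of_symm (fun i k => by rw [N.weight_symm, hcos θ, hcos θ'])
    (by simp)]
  simp only [potential, neg_sub_neg, ← Finset.sum_sub_distrib]
  refine Finset.sum_congr rfl fun i _ => Finset.sum_congr rfl fun k _ => ?_
  split_ifs
  · rw [weight]
    ring
  · exact sub_zero 0

theorem gradU_dotProduct (θ v : Fin n → ℝ) :
    N.gradU θ ⬝ᵥ v = N.lineSum fun i k => Real.sin (θ i - θ k) * (v i - v k) := by
  have hanti : ∀ i k, N.weight k i * Real.sin (θ k - θ i) =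
      -(N.weight i k * Real.sin (θ i - θ k)) := fun i k => by
    rw [N.weight_symm, ← neg_sub, Real.sin_neg, mul_neg]
  simp only [lineSum, ← mul_assoc]
  rw [← sum_sum_mul_of_antisymm hanti]
  simp only [dotProduct, gradU, Finset.sum_mul, weight]

theorem contDiff_potential : ContDiff ℝ 1 N.potential := by
  unfold potential
  refine ContDiff.neg (ContDiff.sum fun i _ => ContDiff.sum fun k _ => ?_)
  split_ifs <;> fun_prop

theorem continuous_gradU : Continuous N.gradU := by
  unfold gradU
  fun_prop

/-- Potential of the error system: the excess of the network potential over its tangent at the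
synchronized angles `θs`, and a term which penalizes uniform rotations. -/
noncomputable def errorPotential (θs a : Fin n → ℝ) (μ : ℝ) (θ : Fin n → ℝ) : ℝ :=
  N.potential (θ + θs) - N.potential θs - N.gradU θs ⬝ᵥ θ + μ / 2 * (a ⬝ᵥ θ) ^ 2

/-- Gradient of the potential of the error system. -/
noncomputable def errorGrad (θs a : Fin n → ℝ) (μ : ℝ) (θ : Fin n → ℝ) : Fin n → ℝ :=
  N.gradU (θ + θs) - N.gradU θs + (μ * (a ⬝ᵥ θ)) • a

variable (θs a : Fin n → ℝ) (μ : ℝ)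

theorem errorGrad_zero : N.errorGrad θs a μ 0 = 0 := by
  simp [errorGrad]

theorem continuous_errorGrad : Continuous (N.errorGrad θs a μ) := by
  have := N.continuous_gradU
  unfold errorGrad dotProduct
  fun_prop

theorem contDiff_errorPotential : ContDiff ℝ 1 (N.errorPotential θs a μ) := by
  have := N.contDiff_potential
  unfold errorPotential dotProduct
  fun_prop

theorem hasDerivAt_errorPotential (θ v : Fin n → ℝ) :
    HasDerivAt (fun s : ℝ => N.errorPotential θs a μ (θ + s • v))
      (N.errorGrad θs a μ θ ⬝ᵥ v) 0 := by
  have hline : HasDerivAt (fun s : ℝ => θ + s • v) v 0 := by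
    simpa using ((hasDerivAt_id (0 : ℝ)).smul_const v).const_add θ
  have hlinear : ∀ b : Fin n → ℝ, HasDerivAt (fun s : ℝ => b ⬝ᵥ (θ + s • v)) (b ⬝ᵥ v) 0 :=
    fun b => by simpa using hasDerivAt_dotProduct (hasDerivAt_const (0 : ℝ) b) hline
  have hpotential : HasDerivAt (fun s : ℝ => N.potential (θ + s • v + θs))
      (N.gradU (θ + θs) ⬝ᵥ v) 0 := by
    simpa only [add_right_comm] using N.hasDerivAt_potential (θ + θs) v
  refine (((hpotential.sub_const (N.potential θs)).sub (hlinear (N.gradU θs))).add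
    (((hlinear a).pow 2).const_mul (μ / 2))).congr_deriv ?_
  simp only [Nat.cast_ofNat, zero_smul, add_zero, Nat.add_one_sub_one, pow_one, errorGrad,
    add_dotProduct, sub_dotProduct, smul_dotProduct, smul_eq_mul, add_right_inj]
  ring

theorem fderiv_errorPotential (θ v : Fin n → ℝ) :
    fderiv ℝ (N.errorPotential θs a μ) θ v = N.errorGrad θs a μ θ ⬝ᵥ v := by
  rw [← ((N.contDiff_errorPotential θs a μ).differentiable one_ne_zero θ).lineDeriv_eq_fderiv]
  exact (N.hasDerivAt_errorPotential θs a μ θ v).deriv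

theorem errorPotential_eq (θ : Fin n → ℝ) :
    N.errorPotential θs a μ θ =
      N.lineSum (fun i k => Real.cos (θs i - θs k) - Real.cos (θs i - θs k + (θ i - θ k)) -
        (θ i - θ k) * Real.sin (θs i - θs k)) + μ / 2 * (a ⬝ᵥ θ) ^ 2 := by
  rw [errorPotential, N.potential_sub, N.gradU_dotProduct, ← N.lineSum_sub]
  congr 3 with i k
  rw [Pi.add_apply, Pi.add_apply, mul_comm (Real.sin _),
    show θ i + θs i - (θ k + θs k) = θs i - θs k + (θ i - θ k) by ring]

theorem errorGrad_dotProduct_self (θ : Fin n → ℝ) :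
    N.errorGrad θs a μ θ ⬝ᵥ θ =
      N.lineSum (fun i k => (Real.sin (θs i - θs k + (θ i - θ k)) - Real.sin (θs i - θs k)) *
        (θ i - θ k)) + μ * (a ⬝ᵥ θ) ^ 2 := by
  rw [errorGrad, add_dotProduct, sub_dotProduct, N.gradU_dotProduct, N.gradU_dotProduct,
    smul_dotProduct, smul_eq_mul, ← N.lineSum_sub, mul_assoc, ← sq]
  congr 2 with i k
  rw [Pi.add_apply, Pi.add_apply, ← sub_mul,
    show θ i + θs i - (θ k + θs k) = θs i - θs k + (θ i - θ k) by ring]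

variable {θs a μ}

/-- The quadratic form with which the potential of the error system is compared. -/
noncomputable def quadForm (a θ : Fin n → ℝ) : ℝ :=
  N.lineSum (fun i k => (θ i - θ k) ^ 2) + (a ⬝ᵥ θ) ^ 2

theorem continuous_quadForm (a : Fin n → ℝ) : Continuous (N.quadForm a) := by
  unfold quadForm lineSum dotProduct
  fun_prop

theorem quadForm_smul (a : Fin n → ℝ) (t : ℝ) (θ : Fin n → ℝ) :
    N.quadForm a (t • θ) = t ^ 2 * N.quadForm a θ := by
  simp only [quadForm, Pi.smul_apply, smul_eq_mul, ← mul_sub, mul_pow, lineSum_const_mul,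
    dotProduct_smul, mul_add]

theorem quadForm_pos (ha : ∀ i, 0 < a i) {θ : Fin n → ℝ} (hθ : θ ≠ 0) : 0 < N.quadForm a θ := by
  have hlines : 0 ≤ N.lineSum fun i k => (θ i - θ k) ^ 2 := by
    refine (N.lineSum_mono (F := fun _ _ => 0) fun i k _ => sq_nonneg _).trans' ?_
    simp [lineSum]
  refine (add_nonneg hlines (sq_nonneg (a ⬝ᵥ θ))).lt_of_ne' fun hzero => hθ (funext fun i => ?_)
  obtain ⟨hlines₀, hmean⟩ := (add_eq_zero_iff_of_nonneg hlines (sq_nonneg _)).1 hzero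
  have hfactor : a ⬝ᵥ θ = (∑ k, a k) * θ i := by
    rw [dotProduct, Finset.sum_mul]
    exact Finset.sum_congr rfl fun k _ => by rw [N.eq_of_lineSum_sq_eq_zero hlines₀ k i]
  rw [hfactor, pow_eq_zero_iff two_ne_zero, mul_eq_zero] at hmean
  exact hmean.resolve_left (Finset.sum_pos (fun k _ => ha k) ⟨i, Finset.mem_univ i⟩).ne'

/-- `b` is an angle below `π / 2` which bounds the phase differences along all lines, at `θs` and
after any perturbation of size at most `r`. -/
structure AngleMargin (θs : Fin n → ℝ) (b r : ℝ) : Prop where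
  radius_pos : 0 < r
  angle_pos : 0 < b
  angle_lt : b < Real.pi / 2
  base : ∀ i k, N.B i k ≠ 0 → |θs i - θs k| ≤ b
  perturbed : ∀ i k, N.B i k ≠ 0 → ∀ θ : Fin n → ℝ, ‖θ‖ ≤ r → |θs i - θs k + (θ i - θ k)| ≤ b

theorem exists_angleMargin (hθs : ∀ i k, N.B i k ≠ 0 → |θs i - θs k| < Real.pi / 2) :
    ∃ b r, N.AngleMargin θs b r := by
  classical
  obtain ⟨a, ha, hmargin⟩ := exists_pos_forall_le (ι := Fin n × Fin n)
    (x := fun e => if N.B e.1 e.2 = 0 then 1 else Real.pi / 2 - |θs e.1 - θs e.2|) fun e => by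
      split_ifs with hB
      · exact one_pos
      · exact sub_pos.2 (hθs _ _ hB)
  have hδ : 0 < min a 1 := by positivity
  have hδ₁ : min a 1 ≤ 1 := min_le_right a 1
  have hbase : ∀ i k, N.B i k ≠ 0 → |θs i - θs k| ≤ Real.pi / 2 - min a 1 := fun i k hB => by
    have hik := (min_le_left a 1).trans (hmargin (i, k))
    simp only [if_neg hB] at hik
    linarith
  refine ⟨Real.pi / 2 - min a 1 / 2, min a 1 / 4, by positivity, by linarith [Real.pi_gt_three],
    by linarith, fun i k hB => by linarith [hbase i k hB], fun i k hB θ hθ => ?_⟩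
  have hi : |θ i| ≤ ‖θ‖ := norm_le_pi_norm θ i
  have hk : |θ k| ≤ ‖θ‖ := norm_le_pi_norm θ k
  linarith [hbase i k hB, abs_add_le (θs i - θs k) (θ i - θ k), abs_sub (θ i) (θ k)]

variable {N} {b r : ℝ} {θ : Fin n → ℝ}

theorem AngleMargin.le_pi (hb : N.AngleMargin θs b r) : b ≤ Real.pi := by
  linarith [hb.angle_lt, Real.pi_pos]

theorem AngleMargin.cos_pos (hb : N.AngleMargin θs b r) : 0 < Real.cos b :=
  Real.cos_pos_of_mem_Ioo ⟨by linarith [hb.angle_pos, Real.pi_pos], hb.angle_lt⟩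

theorem AngleMargin.mul_quadForm_le_errorPotential (hb : N.AngleMargin θs b r) (a : Fin n → ℝ)
    (μ : ℝ) (hθ : ‖θ‖ ≤ r) :
    min (Real.cos b / 2) (μ / 2) * N.quadForm a θ ≤ N.errorPotential θs a μ θ := by
  rw [quadForm, mul_add, ← lineSum_const_mul, N.errorPotential_eq]
  gcongr
  · refine N.lineSum_mono fun i k hB => (mul_le_mul_of_nonneg_right (min_le_left _ _)
      (sq_nonneg _)).trans ?_
    exact le_cos_sub_cos_sub_mul_sin hb.le_pi (hb.base i k hB) (hb.perturbed i k hB θ hθ)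
  · exact min_le_right _ _

theorem errorPotential_le_mul_quadForm (hμ : 0 < μ) :
    N.errorPotential θs a μ θ ≤ (1 + μ) * N.quadForm a θ := by
  rw [quadForm, mul_add, ← lineSum_const_mul, N.errorPotential_eq]
  gcongr
  · refine N.lineSum_mono fun i k _ => (cos_sub_cos_sub_mul_sin_le _ _).trans ?_
    gcongr
    linarith
  · linarith

theorem AngleMargin.mul_quadForm_le_errorGrad (hb : N.AngleMargin θs b r) (a : Fin n → ℝ)
    (hμ : 0 < μ) (hθ : ‖θ‖ ≤ r) :
    min (Real.cos b / 2) (μ / 2) * N.quadForm a θ ≤ N.errorGrad θs a μ θ ⬝ᵥ θ := by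
  have hcos := hb.cos_pos
  rw [quadForm, mul_add, ← lineSum_const_mul, N.errorGrad_dotProduct_self]
  gcongr
  · refine N.lineSum_mono fun i k hB => (mul_le_mul_of_nonneg_right
      ((min_le_left _ _).trans (half_le_self hcos.le)) (sq_nonneg _)).trans ?_
    exact cos_mul_sq_le_sin_sub_sin_mul hb.le_pi (hb.base i k hB) (hb.perturbed i k hB θ hθ)
  · exact (min_le_right _ _).trans (half_le_self hμ.le)

variable (N)

theorem exists_localPotential (hμ : 0 < μ) (ha : ∀ i, 0 < a i)
    (hθs : ∀ i k, N.B i k ≠ 0 → |θs i - θs k| < Real.pi / 2) :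
    ∃ r c C, LocalPotential (N.errorPotential θs a μ) (N.errorGrad θs a μ) r c C := by
  obtain ⟨b, r, hb⟩ := N.exists_angleMargin hθs
  obtain ⟨c, hc, hlower⟩ := exists_pos_mul_l2Norm_sq_le (N.continuous_quadForm a)
    (N.quadForm_smul a) fun θ => N.quadForm_pos ha
  obtain ⟨C, hupper⟩ := exists_le_mul_l2Norm_sq (N.continuous_quadForm a) (N.quadForm_smul a)
  have hcos := hb.cos_pos
  have hquad : ∀ θ : Fin n → ℝ, min (Real.cos b / 2) (μ / 2) * c * ‖θ‖₂ ^ 2 ≤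
      min (Real.cos b / 2) (μ / 2) * N.quadForm a θ := fun θ => by
    rw [mul_assoc]
    gcongr
    exact hlower θ
  exact ⟨r, min (Real.cos b / 2) (μ / 2) * c, (1 + μ) * C,
    { radius_pos := hb.radius_pos
      convexity_pos := by positivity
      contDiff := N.contDiff_errorPotential θs a μ
      fderiv_eq := N.fderiv_errorPotential θs a μ
      lower := fun θ hθ => (hquad θ).trans (hb.mul_quadForm_le_errorPotential a μ hθ)
      upper := fun θ _ => (errorPotential_le_mul_quadForm hμ).trans (by
        rw [mul_assoc]
        gcongr
        exact hupper θ)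
      monotone := fun θ hθ => (hquad θ).trans (hb.mul_quadForm_le_errorGrad a hμ hθ) }⟩

end PowerNetwork

end NetworkPotential

section Laplacian

variable {n : ℕ} {G : SimpleGraph (Fin n)}

theorem sum_channelMatrix {C : Type*} [Fintype C] (G : SimpleGraph (Fin n))
    (ch : Fin n → Fin n → C) : ∑ c, channelMatrix G ch c = laplacian G := by
  classical
  have hlink (i k : Fin n) : ∑ c, (if G.Adj i k ∧ ch i k = c then
      Matrix.single i i (1 : ℝ) - Matrix.single i k 1 else 0) =
      Matrix.single i i (G.adjMatrix ℝ i k) - Matrix.single i k (G.adjMatrix ℝ i k) := by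
    by_cases hik : G.Adj i k <;> simp [hik]
  have hdegree : ∑ i, ∑ k, Matrix.single i i (G.adjMatrix ℝ i k) = G.degMatrix ℝ := by
    ext a b
    simp [Matrix.sum_apply, Matrix.single_apply, SimpleGraph.degMatrix, Matrix.diagonal_apply,
      ite_and, SimpleGraph.degree, SimpleGraph.neighborFinset_eq_filter]
  calc ∑ c, channelMatrix G ch c
      = ∑ i, ∑ k, ∑ c, (if G.Adj i k ∧ ch i k = c then
          Matrix.single i i (1 : ℝ) - Matrix.single i k 1 else 0) := by
        simp only [channelMatrix]
        rw [Finset.sum_comm]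
        exact Finset.sum_congr rfl fun i _ => by rw [Finset.sum_comm]
    _ = G.degMatrix ℝ - G.adjMatrix ℝ := by
        simp only [hlink, Finset.sum_sub_distrib, hdegree, ← Matrix.matrix_eq_sum_single]
    _ = laplacian G := by
        unfold laplacian SimpleGraph.lapMatrix
        convert rfl

theorem posSemidef_laplacian (G : SimpleGraph (Fin n)) : (laplacian G).PosSemidef := by
  classical
  unfold laplacian
  convert SimpleGraph.posSemidef_lapMatrix ℝ G

theorem transpose_laplacian (G : SimpleGraph (Fin n)) : (laplacian G)ᵀ = laplacian G := by
  simpa only [conjTranspose_eq_transpose_of_trivial] using (posSemidef_laplacian G).isHermitian.eq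

theorem dotProduct_laplacian_mulVec_nonneg (G : SimpleGraph (Fin n)) (y : Fin n → ℝ) :
    0 ≤ y ⬝ᵥ laplacian G *ᵥ y := by
  simpa only [star_trivial] using (posSemidef_laplacian G).dotProduct_mulVec_nonneg y

theorem eq_of_dotProduct_laplacian_mulVec_eq_zero (hG : G.Connected) {y : Fin n → ℝ}
    (hy : y ⬝ᵥ laplacian G *ᵥ y = 0) (i k : Fin n) : y i = y k := by
  classical
  refine (G.lapMatrix_toLinearMap₂'_apply'_eq_zero_iff_forall_reachable y).1 ?_ i k
    (hG.preconnected i k)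
  rw [Matrix.toLinearMap₂'_apply']
  unfold laplacian at hy
  convert hy

theorem laplacian_form_add_sq_pos (hG : G.Connected) {w : Fin n → ℝ} (hw : ∀ i, w i ≠ 0)
    {y : Fin n → ℝ} (hy : y ≠ 0) :
    0 < (w * y) ⬝ᵥ laplacian G *ᵥ (w * y) + (w⁻¹ ⬝ᵥ y) ^ 2 := by
  have hnonneg := dotProduct_laplacian_mulVec_nonneg G (w * y)
  refine (add_nonneg hnonneg (sq_nonneg _)).lt_of_ne' fun hzero => hy ?_
  obtain ⟨hform, hsq⟩ := (add_eq_zero_iff_of_nonneg hnonneg (sq_nonneg _)).1 hzero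
  funext k
  have hparallel : y = (w k * y k) • w⁻¹ := by
    funext i
    have hik : w i * y i = w k * y k := eq_of_dotProduct_laplacian_mulVec_eq_zero hG hform i k
    simp only [Pi.smul_apply, Pi.inv_apply, smul_eq_mul, ← hik]
    field_simp [hw i]
  have hself : y ⬝ᵥ y = 0 := by
    conv_lhs => enter [1]; rw [hparallel]
    rw [smul_dotProduct, pow_eq_zero_iff two_ne_zero |>.1 hsq, smul_zero]
  exact congrFun (dotProduct_self_eq_zero.1 hself) k

end Laplacian

section Reduction

variable {n : ℕ} {K A : Fin n → ℝ} {W : Matrix (Fin n) (Fin (n - 1)) ℝ} {κ : ℝ}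

/-- The diagonal of `A K^{1/2}`; its entrywise inverse is `kernelVec K A`. -/
noncomputable def nodeScale (K A : Fin n → ℝ) : Fin n → ℝ := fun i => A i * √(K i)

theorem nodeScale_pos (hK : ∀ i, 0 < K i) (hA : ∀ i, 0 < A i) (i : Fin n) :
    0 < nodeScale K A i :=
  mul_pos (hA i) (Real.sqrt_pos.2 (hK i))

theorem kernelVec_eq_inv_nodeScale (K A : Fin n → ℝ) : kernelVec K A = (nodeScale K A)⁻¹ :=
  funext fun _ => (_root_.mul_inv_rev _ _).symm

theorem nodeScale_smul (hκ : 0 ≤ κ) (K A : Fin n → ℝ) :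
    nodeScale (κ • K) A = √κ • nodeScale K A := by
  funext i
  simp only [nodeScale, Pi.smul_apply, smul_eq_mul, Real.sqrt_mul hκ]
  ring

theorem sqrtGain_smul (hκ : 0 ≤ κ) (K : Fin n → ℝ) : sqrtGain (κ • K) = √κ • sqrtGain K := by
  rw [sqrtGain, sqrtGain, ← Matrix.diagonal_smul]
  congr 1
  funext i
  simp [Real.sqrt_mul hκ]

theorem reduced_eq (K A : Fin n → ℝ) (W : Matrix (Fin n) (Fin (n - 1)) ℝ)
    (X : Matrix (Fin n) (Fin n) ℝ) :
    reduced K A W X = (diagonal (nodeScale K A) * W)ᵀ * X * (diagonal (nodeScale K A) * W) := by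
  have hscale : diagonal (nodeScale K A) = diagonal A * sqrtGain K :=
    (diagonal_mul_diagonal _ _).symm
  simp only [reduced, hscale, sqrtGain, transpose_mul, diagonal_transpose, Matrix.mul_assoc]

theorem reduced_sum {C : Type*} (s : Finset C) (K A : Fin n → ℝ)
    (W : Matrix (Fin n) (Fin (n - 1)) ℝ) (X : C → Matrix (Fin n) (Fin n) ℝ) :
    ∑ c ∈ s, reduced K A W (X c) = reduced K A W (∑ c ∈ s, X c) := by
  simp only [reduced_eq, Matrix.mul_sum, Matrix.sum_mul]

theorem reduced_smul (hκ : 0 ≤ κ) (K A : Fin n → ℝ) (W : Matrix (Fin n) (Fin (n - 1)) ℝ)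
    (X : Matrix (Fin n) (Fin n) ℝ) : reduced (κ • K) A W X = κ • reduced K A W X := by
  rw [reduced_eq, reduced_eq, nodeScale_smul hκ, diagonal_smul, Matrix.smul_mul, transpose_smul,
    Matrix.smul_mul, Matrix.smul_mul, Matrix.mul_smul, smul_smul, Real.mul_self_sqrt hκ]

theorem transpose_reduced_laplacian (K A : Fin n → ℝ) (W : Matrix (Fin n) (Fin (n - 1)) ℝ)
    (G : SimpleGraph (Fin n)) :
    (reduced K A W (laplacian G))ᵀ = reduced K A W (laplacian G) := by
  simp only [reduced_eq, transpose_mul, transpose_transpose, transpose_laplacian, Matrix.mul_assoc]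

theorem dotProduct_reduced_mulVec (K A : Fin n → ℝ) (W : Matrix (Fin n) (Fin (n - 1)) ℝ)
    (X : Matrix (Fin n) (Fin n) ℝ) (x : Fin (n - 1) → ℝ) :
    x ⬝ᵥ reduced K A W X *ᵥ x =
      (nodeScale K A * (W *ᵥ x)) ⬝ᵥ X *ᵥ (nodeScale K A * (W *ᵥ x)) := by
  have hscale : nodeScale K A * (W *ᵥ x) = (diagonal (nodeScale K A) * W) *ᵥ x := by
    rw [← mulVec_mulVec]
    exact funext fun i => (mulVec_diagonal _ _ i).symm
  rw [hscale, reduced_eq, ← mulVec_mulVec, ← mulVec_mulVec, dotProduct_mulVec, vecMul_transpose]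

theorem IsReduction.of_smul (hκ : 0 < κ) (hW : IsReduction (κ • K) A W) : IsReduction K A W := by
  have hkernel : kernelVec K A = √κ • kernelVec (κ • K) A := by
    have := (Real.sqrt_pos.2 hκ).ne'
    funext i
    simp only [kernelVec, Pi.smul_apply, smul_eq_mul, Real.sqrt_mul hκ.le, mul_inv]
    field_simp
  exact ⟨hW.1, by rw [hkernel, mulVec_smul, hW.2, smul_zero]⟩

theorem IsReduction.l2Norm_mulVec (hW : IsReduction K A W) (x : Fin (n - 1) → ℝ) :
    ‖W *ᵥ x‖₂ ^ 2 = ‖x‖₂ ^ 2 := by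
  rw [l2Norm_sq, l2Norm_sq, dotProduct_mulVec, ← mulVec_transpose, mulVec_mulVec, hW.1, one_mulVec]

theorem IsReduction.kernelVec_dotProduct_mulVec (hW : IsReduction K A W) (x : Fin (n - 1) → ℝ) :
    kernelVec K A ⬝ᵥ W *ᵥ x = 0 := by
  rw [dotProduct_mulVec, ← mulVec_transpose, hW.2, zero_dotProduct]

theorem norm_one_le_one {m : Type*} [Fintype m] [DecidableEq m] : ‖(1 : Matrix m m ℝ)‖ ≤ 1 := by
  rw [← Matrix.diagonal_one, Matrix.l2_opNorm_diagonal]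
  exact (pi_norm_le_iff_of_nonneg zero_le_one).2 fun _ => norm_one.le

theorem IsReduction.norm_le_one (hW : IsReduction K A W) : ‖W‖ ≤ 1 := by
  have hsq : ‖(1 : Matrix (Fin (n - 1)) (Fin (n - 1)) ℝ)‖ = ‖W‖ * ‖W‖ := by
    rw [← Matrix.l2_opNorm_conjTranspose_mul_self, conjTranspose_eq_transpose_of_trivial, hW.1]
  exact le_of_sq_le_sq (by linarith [norm_one_le_one (m := Fin (n - 1))]) zero_le_one

theorem IsReduction.norm_mul_le (hW : IsReduction K A W) (X : Matrix (Fin n) (Fin n) ℝ) :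
    ‖X * W‖ ≤ ‖X‖ :=
  (Matrix.l2_opNorm_mul _ _).trans (mul_le_of_le_one_right (norm_nonneg _) hW.norm_le_one)

theorem IsReduction.norm_sqrtGain_smul_mul_le (hκ : 0 < κ) (hW : IsReduction (κ • K) A W) :
    ‖sqrtGain (κ • K) * W‖ ≤ √κ * ‖sqrtGain K‖ := by
  refine (hW.norm_mul_le _).trans_eq ?_
  rw [sqrtGain_smul hκ.le, norm_smul, Real.norm_of_nonneg (Real.sqrt_nonneg _)]

theorem IsReduction.norm_reduced_le (hW : IsReduction K A W) (X : Matrix (Fin n) (Fin n) ℝ) :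
    ‖reduced K A W X‖ ≤ ‖nodeScale K A‖ ^ 2 * ‖X‖ := by
  have hscale : ‖diagonal (nodeScale K A) * W‖ ≤ ‖nodeScale K A‖ :=
    (hW.norm_mul_le _).trans_eq (Matrix.l2_opNorm_diagonal _)
  calc ‖reduced K A W X‖
      ≤ ‖(diagonal (nodeScale K A) * W)ᵀ‖ * ‖X‖ * ‖diagonal (nodeScale K A) * W‖ := by
        rw [reduced_eq]
        exact (Matrix.l2_opNorm_mul _ _).trans (by gcongr; exact Matrix.l2_opNorm_mul _ _)
    _ = ‖diagonal (nodeScale K A) * W‖ ^ 2 * ‖X‖ := by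
        rw [← conjTranspose_eq_transpose_of_trivial, Matrix.l2_opNorm_conjTranspose]
        ring
    _ ≤ ‖nodeScale K A‖ ^ 2 * ‖X‖ := by gcongr

variable {ι : Type*} [Finite ι] {G : ι → SimpleGraph (Fin n)}

theorem exists_norm_reduced_le (K A : Fin n → ℝ) (X : ι → Matrix (Fin n) (Fin n) ℝ) :
    ∃ b, ∀ W, IsReduction K A W → ∀ ℓ, ‖reduced K A W (X ℓ)‖ ≤ b := by
  obtain ⟨b, hb⟩ := (finite_range fun ℓ => ‖X ℓ‖).bddAbove
  refine ⟨‖nodeScale K A‖ ^ 2 * b, fun W hW ℓ => (hW.norm_reduced_le _).trans ?_⟩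
  gcongr
  exact hb ⟨ℓ, rfl⟩

theorem exists_reduced_laplacian_coercive (hG : ∀ ℓ, (G ℓ).Connected) (hK : ∀ i, 0 < K i)
    (hA : ∀ i, 0 < A i) :
    ∃ lam > 0, ∀ W, IsReduction K A W → ∀ ℓ x,
      lam * ‖x‖₂ ^ 2 ≤ x ⬝ᵥ reduced K A W (laplacian (G ℓ)) *ᵥ x := by
  have hform (ℓ : ι) : ∃ lam > 0, ∀ y, lam * ‖y‖₂ ^ 2 ≤
      (nodeScale K A * y) ⬝ᵥ laplacian (G ℓ) *ᵥ (nodeScale K A * y) +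
        ((nodeScale K A)⁻¹ ⬝ᵥ y) ^ 2 := by
    refine exists_pos_mul_l2Norm_sq_le ?_ (fun t y => ?_) fun y hy =>
      laplacian_form_add_sq_pos (hG ℓ) (fun i => (nodeScale_pos hK hA i).ne') hy
    · have hscale : Continuous fun y : Fin n → ℝ => nodeScale K A * y := by fun_prop
      exact (hscale.dotProduct (continuous_const.matrix_mulVec hscale)).add
        ((continuous_const.dotProduct continuous_id).pow 2)
    · simp only [mul_smul_comm, mulVec_smul, dotProduct_smul, smul_dotProduct, smul_eq_mul]
      ring
  choose lam hlam hle using hform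
  obtain ⟨lam₀, hlam₀, hmin⟩ := exists_pos_forall_le hlam
  refine ⟨lam₀, hlam₀, fun W hW ℓ x => ?_⟩
  calc lam₀ * ‖x‖₂ ^ 2 ≤ lam ℓ * ‖W *ᵥ x‖₂ ^ 2 := by
        rw [hW.l2Norm_mulVec]
        exact mul_le_mul_of_nonneg_right (hmin ℓ) (sq_nonneg _)
    _ ≤ _ := hle ℓ (W *ᵥ x)
    _ = x ⬝ᵥ reduced K A W (laplacian (G ℓ)) *ᵥ x := by
        rw [← kernelVec_eq_inv_nodeScale, hW.kernelVec_dotProduct_mulVec,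
          dotProduct_reduced_mulVec, zero_pow two_ne_zero, add_zero]

theorem eventually_exists_gainBounds (hG : ∀ ℓ, (G ℓ).Connected) {D : Fin n → ℝ}
    (hA : ∀ i, 0 < A i) (hD : ∀ i, 0 < D i) (hK : ∀ i, 0 < K i) {h : ℝ} (hh : 0 ≤ h) :
    ∀ᶠ κ in 𝓝[>] (0 : ℝ), ∀ W, IsReduction (κ • K) A W → ∃ d l lam γ,
      GainBounds D (sqrtGain (κ • K) * W)
        (fun ℓ => reduced (κ • K) A W (laplacian (G ℓ))) h d l lam γ := by
  obtain ⟨d, hd, hdamping⟩ := exists_pos_forall_le hD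
  obtain ⟨lam, hlam, hcoercive⟩ := exists_reduced_laplacian_coercive hG hK hA
  obtain ⟨l, hfeedback⟩ := exists_norm_reduced_le K A fun ℓ => laplacian (G ℓ)
  obtain ⟨γ, hγ⟩ : ∃ γ, γ = l ^ 2 * h / lam + 1 := ⟨_, rfl⟩
  have hγpos : 0 < γ := by rw [hγ]; positivity
  filter_upwards [self_mem_nhdsWithin, eventually_mul_le 1 one_pos,
    eventually_mul_le (2 * γ * h * ‖sqrtGain K‖ ^ 2) (half_pos hd),
    eventually_mul_le (4 * γ * h * l ^ 2) (show 0 < lam / 4 by positivity),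
    eventually_mul_le (8 * γ * h ^ 2 * l ^ 2) one_half_pos]
    with κ (hκ : 0 < κ) hκ₁ hκd hκlam hκγ W hW
  have hκsq : κ ^ 2 ≤ κ := by nlinarith
  have hB : ‖sqrtGain (κ • K) * W‖ ^ 2 ≤ κ * ‖sqrtGain K‖ ^ 2 := by
    refine (pow_le_pow_left₀ (norm_nonneg _) (hW.norm_sqrtGain_smul_mul_le hκ) 2).trans_eq ?_
    rw [mul_pow, Real.sq_sqrt hκ.le]
  refine ⟨d, κ * l, κ * lam, κ * γ, hh, hd, by positivity, by positivity, hdamping,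
    fun ℓ => ?_, fun ℓ x => ?_, ?_, ?_, ?_⟩
  · rw [reduced_smul hκ.le, norm_smul, Real.norm_of_nonneg hκ.le]
    exact mul_le_mul_of_nonneg_left (hfeedback W (hW.of_smul hκ) ℓ) hκ.le
  · rw [reduced_smul hκ.le, smul_mulVec, dotProduct_smul, smul_eq_mul, mul_assoc]
    exact mul_le_mul_of_nonneg_left (hcoercive W (hW.of_smul hκ) ℓ x) hκ.le
  · calc 2 * (κ * γ) * h * ‖sqrtGain (κ • K) * W‖ ^ 2
        ≤ 2 * (κ * γ) * h * (κ * ‖sqrtGain K‖ ^ 2) := by gcongr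
      _ = κ ^ 2 * (2 * γ * h * ‖sqrtGain K‖ ^ 2) := by ring
      _ ≤ κ * (2 * γ * h * ‖sqrtGain K‖ ^ 2) := by gcongr
      _ ≤ d / 2 := hκd
  · calc 4 * (κ * γ) * h * (κ * l) ^ 2 = κ * (κ ^ 2 * (4 * γ * h * l ^ 2)) := by ring
      _ ≤ κ * (κ * (4 * γ * h * l ^ 2)) := by gcongr
      _ ≤ κ * (lam / 4) := by gcongr
      _ = κ * lam / 4 := by ring
  · calc 2 * h * ((κ * l) ^ 2 / (2 * (κ * lam)) + 4 * (κ * γ) * h * (κ * l) ^ 2)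
        = κ * (l ^ 2 * h / lam + κ ^ 2 * (8 * γ * h ^ 2 * l ^ 2)) := by field
      _ ≤ κ * (l ^ 2 * h / lam + κ * (8 * γ * h ^ 2 * l ^ 2)) := by gcongr
      _ ≤ κ * (l ^ 2 * h / lam + 1 / 2) := by gcongr
      _ < κ * γ := by rw [hγ]; gcongr; norm_num

end Reduction

section BlockMatrices

variable {m p C : Type*} [Fintype m] [Fintype p] [Fintype C]

theorem dotProduct_fromBlocks_mulVec (A : Matrix m m ℝ) (B : Matrix m p ℝ) (E : Matrix p p ℝ)
    (x : m → ℝ) (y : p → ℝ) :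
    Sum.elim x y ⬝ᵥ Matrix.fromBlocks A B Bᵀ E *ᵥ Sum.elim x y =
      x ⬝ᵥ A *ᵥ x + 2 * (x ⬝ᵥ B *ᵥ y) + y ⬝ᵥ E *ᵥ y := by
  have htranspose : y ⬝ᵥ Bᵀ *ᵥ x = x ⬝ᵥ B *ᵥ y := by
    rw [dotProduct_mulVec, vecMul_transpose, dotProduct_comm]
  rw [Matrix.fromBlocks_mulVec, sumElim_dotProduct_sumElim]
  simp only [Sum.elim_comp_inl, Sum.elim_comp_inr, dotProduct_add, htranspose]
  ring

theorem l2Norm_sumElim_sq (x : m → ℝ) (y : p → ℝ) :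
    ‖Sum.elim x y‖₂ ^ 2 = ‖x‖₂ ^ 2 + ‖y‖₂ ^ 2 := by
  simp only [l2Norm_sq, sumElim_dotProduct_sumElim]

theorem sum_l2Norm_slice_sq (y : p × C → ℝ) :
    ∑ c, ‖fun j => y (j, c)‖₂ ^ 2 = ‖y‖₂ ^ 2 := by
  simp only [l2Norm_sq, dotProduct, Fintype.sum_prod_type_right]

theorem l2Norm_slice_le (y : p × C → ℝ) (c : C) : ‖fun j => y (j, c)‖₂ ≤ ‖y‖₂ := by
  refine le_of_sq_le_sq ?_ (l2Norm_nonneg y)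
  rw [← sum_l2Norm_slice_sq y]
  exact Finset.single_le_sum (f := fun c => ‖fun j => y (j, c)‖₂ ^ 2) (fun c _ => sq_nonneg _)
    (Finset.mem_univ c)

theorem l2Norm_sum_le {ι : Type*} (s : Finset ι) (x : ι → m → ℝ) :
    ‖∑ i ∈ s, x i‖₂ ≤ ∑ i ∈ s, ‖x i‖₂ := by
  rw [l2Norm, WithLp.toLp_sum]
  exact norm_sum_le s _

theorem exists_pos_mul_l2Norm_sq_le_of_posDef {M : Matrix p p ℝ} (hM : M.PosDef) :
    ∃ c > 0, ∀ x, c * ‖x‖₂ ^ 2 ≤ x ⬝ᵥ M *ᵥ x := by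
  refine exists_pos_mul_l2Norm_sq_le ?_ (fun t x => ?_) fun x hx => ?_
  · exact continuous_id.dotProduct (continuous_const.matrix_mulVec continuous_id)
  · simp only [mulVec_smul, dotProduct_smul, smul_dotProduct, smul_eq_mul]
    ring
  · simpa only [star_trivial] using hM.dotProduct_mulVec_pos hx

theorem blockDiagonal_mulVec_apply [DecidableEq C] (X : C → Matrix p p ℝ) (y : p × C → ℝ) (j : p)
    (c : C) :
    (blockDiagonal X *ᵥ y) (j, c) = (X c *ᵥ fun i => y (i, c)) j := by
  simp only [mulVec, dotProduct, Fintype.sum_prod_type, Matrix.blockDiagonal_apply, ite_mul,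
    zero_mul, Finset.sum_ite_eq, Finset.mem_univ, if_true]

theorem dotProduct_blockDiagonal_mulVec_nonneg [DecidableEq C] {X : C → Matrix p p ℝ}
    (hX : ∀ c, (X c).PosSemidef) (y : p × C → ℝ) : 0 ≤ y ⬝ᵥ blockDiagonal X *ᵥ y := by
  rw [dotProduct, Fintype.sum_prod_type_right]
  simp only [blockDiagonal_mulVec_apply]
  exact Finset.sum_nonneg fun c _ => by
    simpa only [star_trivial, dotProduct] using
      (hX c).dotProduct_mulVec_nonneg fun i => y (i, c)

variable [DecidableEq p] {b : ℝ}

theorem norm_le_of_l2Norm_mulVec_le {A : Matrix m p ℝ} (hb : 0 ≤ b)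
    (hA : ∀ x, ‖A *ᵥ x‖₂ ≤ b * ‖x‖₂) : ‖A‖ ≤ b := by
  rw [Matrix.l2_opNorm_def]
  exact ContinuousLinearMap.opNorm_le_bound _ hb fun x => hA x.ofLp

variable [DecidableEq C]

theorem norm_blockRow_le {X : C → Matrix m p ℝ} (hb : 0 ≤ b) (hX : ∀ c, ‖X c‖ ≤ b) :
    ‖blockRow X‖ ≤ Fintype.card C * b := by
  refine norm_le_of_l2Norm_mulVec_le (by positivity) fun y => ?_
  have hsum : blockRow X *ᵥ y = ∑ c, X c *ᵥ fun j => y (j, c) := by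
    funext i
    simp only [blockRow, mulVec, dotProduct, Matrix.of_apply, Finset.sum_apply,
      Fintype.sum_prod_type_right]
  calc ‖blockRow X *ᵥ y‖₂ ≤ ∑ c, ‖X c *ᵥ fun j => y (j, c)‖₂ := by
        rw [hsum]
        exact l2Norm_sum_le _ _
    _ ≤ ∑ _c : C, b * ‖y‖₂ := Finset.sum_le_sum fun c _ => (l2Norm_mulVec_le _ _).trans
        (mul_le_mul (hX c) (l2Norm_slice_le y c) (l2Norm_nonneg _) hb)
    _ = Fintype.card C * b * ‖y‖₂ := by
        rw [Finset.sum_const, Finset.card_univ, nsmul_eq_mul, mul_assoc]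

theorem norm_blockDiagonal_le {X : C → Matrix p p ℝ} (hb : 0 ≤ b) (hX : ∀ c, ‖X c‖ ≤ b) :
    ‖blockDiagonal X‖ ≤ b := by
  refine norm_le_of_l2Norm_mulVec_le hb fun y => ?_
  refine le_of_sq_le_sq ?_ (mul_nonneg hb (l2Norm_nonneg y))
  calc ‖blockDiagonal X *ᵥ y‖₂ ^ 2 = ∑ c, ‖X c *ᵥ fun j => y (j, c)‖₂ ^ 2 := by
        simp only [← sum_l2Norm_slice_sq (blockDiagonal X *ᵥ y), blockDiagonal_mulVec_apply]
    _ ≤ ∑ c, (b * ‖fun j => y (j, c)‖₂) ^ 2 := Finset.sum_le_sum fun c _ =>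
        pow_le_pow_left₀ (l2Norm_nonneg _) ((l2Norm_mulVec_le _ _).trans
          (mul_le_mul_of_nonneg_right (hX c) (l2Norm_nonneg _))) 2
    _ = (b * ‖y‖₂) ^ 2 := by
        simp only [mul_pow, ← Finset.mul_sum, sum_l2Norm_slice_sq]

theorem norm_mul_mul_le {q r : Type*} [Fintype q] [Fintype r] [DecidableEq q] [DecidableEq r]
    {X : Matrix m q ℝ} {Y : Matrix q r ℝ} {Z : Matrix r p ℝ} {a b c : ℝ} (hX : ‖X‖ ≤ a)
    (hY : ‖Y‖ ≤ b) (hZ : ‖Z‖ ≤ c) : ‖X * Y * Z‖ ≤ a * b * c := by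
  have ha : 0 ≤ a := (norm_nonneg _).trans hX
  have hb : 0 ≤ b := (norm_nonneg _).trans hY
  calc ‖X * Y * Z‖ ≤ ‖X‖ * ‖Y‖ * ‖Z‖ :=
        (Matrix.l2_opNorm_mul _ _).trans (by gcongr; exact Matrix.l2_opNorm_mul _ _)
    _ ≤ a * b * c := by gcongr

theorem abs_dotProduct_mulVec_le_mul {X : Matrix m p ℝ} {ε u v Q : ℝ} (hε : 0 ≤ ε)
    (hX : ‖X‖ ≤ ε * (u * v)) {x : m → ℝ} {y : p → ℝ} (hx : (u * ‖x‖₂) ^ 2 ≤ Q)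
    (hy : (v * ‖y‖₂) ^ 2 ≤ Q) : |x ⬝ᵥ X *ᵥ y| ≤ ε * Q := by
  have hx₀ := l2Norm_nonneg x
  have hy₀ := l2Norm_nonneg y
  calc |x ⬝ᵥ X *ᵥ y| ≤ ‖X‖ * ‖x‖₂ * ‖y‖₂ := abs_dotProduct_mulVec_le X x y
    _ ≤ ε * (u * v) * ‖x‖₂ * ‖y‖₂ := by gcongr
    _ = ε * ((u * ‖x‖₂) * (v * ‖y‖₂)) := by ring
    _ ≤ ε * Q := by
        gcongr
        linarith [two_mul_le_add_sq (u * ‖x‖₂) (v * ‖y‖₂)]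

end BlockMatrices

section Remainder

variable {m p C : Type*} [Fintype m] [Fintype p]

/-- The part of the quadratic form of `Psi` that is of higher order in the square root `s` of the
gain, as a function of `B = K^{1/2} W`, the reduced Laplacian `L`, the reduced channel matrices `T`,
`Rbar` and `S`. -/
noncomputable def psiRemainder [Fintype C] [DecidableEq C] (B : Matrix m p ℝ)
    (L Rbar : Matrix p p ℝ) (T S : C → Matrix p p ℝ) (x₁ : m → ℝ) (x₂ : p → ℝ)
    (x₃ x₄ : p × C → ℝ) : ℝ :=
  -(x₁ ⬝ᵥ (B * Rbar * Bᵀ) *ᵥ x₁) + 2 * (x₁ ⬝ᵥ (B * Rbar * L) *ᵥ x₂)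
    - x₂ ⬝ᵥ (L * Rbar * L) *ᵥ x₂ + 2 * (x₁ ⬝ᵥ blockRow (fun c => -(B * Rbar * T c)) *ᵥ x₄)
    - 2 * (x₂ ⬝ᵥ blockRow S *ᵥ x₃)
    + 2 * (x₂ ⬝ᵥ blockRow (fun c => L * Rbar * T c - S c - (1 / 2 : ℝ) • T c) *ᵥ x₄)
    + x₄ ⬝ᵥ blockDiagonal (fun c => -((T c)ᵀ * Rbar * T c)) *ᵥ x₄

variable [DecidableEq p] {B : Matrix m p ℝ} {L Rbar : Matrix p p ℝ} {T S : C → Matrix p p ℝ}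
  {s b : ℝ}

theorem norm_transpose_le [DecidableEq m] {X : Matrix m p ℝ} (hX : ‖X‖ ≤ b) : ‖Xᵀ‖ ≤ b := by
  rwa [← conjTranspose_eq_transpose_of_trivial, Matrix.l2_opNorm_conjTranspose]

theorem norm_channelBlock_le (hs : 0 ≤ s) (hs₁ : s ≤ 1) (hL : ‖L‖ ≤ s ^ 2 * b)
    (hR : ‖Rbar‖ ≤ b) {T S : Matrix p p ℝ} (hT : ‖T‖ ≤ s ^ 2 * b) (hS : ‖S‖ ≤ s ^ 2) :
    ‖L * Rbar * T - S - (1 / 2 : ℝ) • T‖ ≤ s ^ 2 * (b ^ 3 + b + 1) := by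
  have hb : 0 ≤ b := (norm_nonneg _).trans hR
  have hproduct : ‖L * Rbar * T‖ ≤ s ^ 2 * b ^ 3 := by
    refine (norm_mul_mul_le hL hR hT).trans ?_
    calc s ^ 2 * b * b * (s ^ 2 * b) = s ^ 2 * (s ^ 2 * b ^ 3) := by ring
      _ ≤ s ^ 2 * b ^ 3 := by
          gcongr
          exact mul_le_of_le_one_left (by positivity) (pow_le_one₀ hs hs₁)
  have hhalf : ‖(1 / 2 : ℝ) • T‖ ≤ s ^ 2 * b := by
    rw [norm_smul, Real.norm_of_nonneg one_half_pos.le]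
    linarith [norm_nonneg T]
  calc _ ≤ ‖L * Rbar * T‖ + ‖S‖ + ‖(1 / 2 : ℝ) • T‖ :=
        (norm_sub_le _ _).trans (by gcongr; exact norm_sub_le _ _)
    _ ≤ s ^ 2 * b ^ 3 + s ^ 2 + s ^ 2 * b := by gcongr
    _ = s ^ 2 * (b ^ 3 + b + 1) := by ring

theorem pow_mul_cube_le {k : ℝ} (hs : 0 ≤ s) (hs₁ : s ≤ 1) (hb : 0 ≤ b) (hk : 0 ≤ k) (i j : ℕ) :
    s ^ i * (s ^ j * ((k + 1) * b ^ 3)) ≤ s ^ i * ((k + 1) * (b ^ 3 + b + 1)) := by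
  refine mul_le_mul_of_nonneg_left ?_ (pow_nonneg hs i)
  refine (mul_le_of_le_one_left (by positivity) (pow_le_one₀ hs hs₁)).trans ?_
  gcongr
  linarith

variable [Fintype C] [DecidableEq C]

theorem abs_psiRemainder_le (hs : 0 ≤ s) (hs₁ : s ≤ 1) (hB : ‖B‖ ≤ s * b)
    (hL : ‖L‖ ≤ s ^ 2 * b) (hR : ‖Rbar‖ ≤ b) (hT : ∀ c, ‖T c‖ ≤ s ^ 2 * b)
    (hS : ∀ c, ‖S c‖ ≤ s ^ 2) {x₁ : m → ℝ} {x₂ : p → ℝ} {x₃ x₄ : p × C → ℝ} {Q : ℝ}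
    (hx₁ : (1 * ‖x₁‖₂) ^ 2 ≤ Q) (hx₂ : (s * ‖x₂‖₂) ^ 2 ≤ Q) (hx₃ : (1 * ‖x₃‖₂) ^ 2 ≤ Q)
    (hx₄ : (1 * ‖x₄‖₂) ^ 2 ≤ Q) :
    |psiRemainder B L Rbar T S x₁ x₂ x₃ x₄| ≤
      11 * (s * ((Fintype.card C + 1) * (b ^ 3 + b + 1)) * Q) := by
  classical
  have hb : 0 ≤ b := (norm_nonneg _).trans hR
  obtain ⟨k, hk⟩ : ∃ k : ℝ, k = Fintype.card C := ⟨_, rfl⟩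
  have hk₀ : 0 ≤ k := hk ▸ Nat.cast_nonneg _
  have hε : 0 ≤ s * ((k + 1) * (b ^ 3 + b + 1)) := by positivity
  have hpow := pow_mul_cube_le hs hs₁ hb hk₀
  have hcube (i : ℕ) : 0 ≤ s ^ i * b ^ 3 := by positivity
  have hkcube (i : ℕ) : 0 ≤ k * (s ^ i * b ^ 3) := by positivity
  have h₁₁ := abs_dotProduct_mulVec_le_mul (X := B * Rbar * Bᵀ) hε
    ((norm_mul_mul_le hB hR (norm_transpose_le hB)).trans
      (by linarith [hpow 1 1, hkcube 2])) hx₁ hx₁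
  have h₁₂ := abs_dotProduct_mulVec_le_mul (X := B * Rbar * L) hε
    ((norm_mul_mul_le hB hR hL).trans (by linarith [hpow 2 1, hkcube 3])) hx₁ hx₂
  have h₂₂ := abs_dotProduct_mulVec_le_mul (X := L * Rbar * L) hε
    ((norm_mul_mul_le hL hR hL).trans (by linarith [hpow 3 1, hkcube 4])) hx₂ hx₂
  have h₁₄ := abs_dotProduct_mulVec_le_mul (X := blockRow fun c => -(B * Rbar * T c)) hε
    ((norm_blockRow_le (hcube 3) fun c => by
      rw [norm_neg]
      linarith [norm_mul_mul_le hB hR (hT c)]).trans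
        (by rw [← hk]; linarith [hpow 1 2, hcube 3])) hx₁ hx₄
  have h₂₃ := abs_dotProduct_mulVec_le_mul (X := blockRow S) hε
    ((norm_blockRow_le (sq_nonneg s) hS).trans (by
      have hrest : 0 ≤ s ^ 2 * ((k + 1) * (b ^ 3 + b) + 1) := by positivity
      rw [← hk]
      linarith)) hx₂ hx₃
  have h₂₄ := abs_dotProduct_mulVec_le_mul hε
    ((norm_blockRow_le (by positivity) fun c =>
      norm_channelBlock_le hs hs₁ hL hR (hT c) (hS c)).trans (by
        have hrest : 0 ≤ s ^ 2 * (b ^ 3 + b + 1) := by positivity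
        rw [← hk]
        linarith)) hx₂ hx₄
  have h₄₄ := abs_dotProduct_mulVec_le_mul
    (X := blockDiagonal fun c => -((T c)ᵀ * Rbar * T c)) hε
    ((norm_blockDiagonal_le (hcube 4) fun c => by
      rw [norm_neg]
      linarith [norm_mul_mul_le (norm_transpose_le (hT c)) hR (hT c)]).trans
        (by linarith [hpow 1 3, hkcube 4])) hx₄ hx₄
  rw [psiRemainder, ← hk, abs_le]
  rw [abs_le] at h₁₁ h₁₂ h₂₂ h₁₄ h₂₃ h₂₄ h₄₄
  constructor <;> linarith

end Remainder

section SmallGain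

theorem tendsto_sqrt_nhdsGT_zero : Tendsto Real.sqrt (𝓝[>] 0) (𝓝[>] 0) :=
  tendsto_nhdsWithin_iff.2 ⟨(Real.continuous_sqrt.tendsto' 0 0 Real.sqrt_zero).mono_left
    nhdsWithin_le_nhds, eventually_mem_nhdsWithin.mono fun _ => Real.sqrt_pos.2⟩

variable {n : ℕ} {C : Type*} [DecidableEq C] {D A K : Fin n → ℝ}
  {W : Matrix (Fin n) (Fin (n - 1)) ℝ} {G : SimpleGraph (Fin n)} {ch : Fin n → Fin n → C}
  {h : C → ℝ} {R S S12 : C → Matrix (Fin (n - 1)) (Fin (n - 1)) ℝ}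

theorem posDef_of_couplingMatrix_posDef (hRS : (couplingMatrix R S12).PosDef) (c : C) :
    (R c).PosDef := by
  have hblock := hRS.submatrix (e := fun i : Fin (n - 1) => Sum.inl (i, c)) fun i j hij =>
    congrArg Prod.fst (Sum.inl_injective hij)
  rwa [show (couplingMatrix R S12).submatrix _ _ = R c by
    ext i j
    exact Matrix.blockDiagonal_apply_eq R i j c] at hblock

variable [Fintype C]

theorem isHermitian_Psi (hR : ∀ c, (R c).IsHermitian) (hS : ∀ c, (S c).IsHermitian) :
    (Psi D A K W G ch h R S S12).IsHermitian := by
  have hRbar : (∑ c, h c ^ 2 • R c)ᵀ = ∑ c, h c ^ 2 • R c := by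
    simp only [transpose_sum, transpose_smul, (isHermitian_iff_isSymm.1 (hR _)).eq]
  have hL := transpose_reduced_laplacian K A W G
  have hRblock := Matrix.isHermitian_blockDiagonal_iff.2 hR
  have hSblock := Matrix.isHermitian_blockDiagonal_iff.2 hS
  have hT := Matrix.isHermitian_blockDiagonal_iff.2 fun c =>
    isHermitian_iff_isSymm.2 (show (-((reduced K A W (channelMatrix G ch c))ᵀ *
      (∑ c, h c ^ 2 • R c) * reduced K A W (channelMatrix G ch c))).IsSymm by
      simp only [IsSymm, transpose_neg, transpose_mul, transpose_transpose, hRbar,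
        Matrix.mul_assoc])
  have h₁₁ : (sqrtGain K * W * (∑ c, h c ^ 2 • R c) * (sqrtGain K * W)ᵀ).IsHermitian := by
    rw [isHermitian_iff_isSymm, IsSymm]
    simp only [transpose_mul, transpose_transpose, hRbar, Matrix.mul_assoc]
  have h₂₂ : (reduced K A W (laplacian G) * (∑ c, h c ^ 2 • R c) *
      reduced K A W (laplacian G)).IsHermitian := by
    rw [isHermitian_iff_isSymm, IsSymm]
    simp only [transpose_mul, hL, hRbar, Matrix.mul_assoc]
  exact ((isHermitian_diagonal _).sub h₁₁ |>.fromBlocks rfl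
      ((isHermitian_iff_isSymm.2 hL).sub h₂₂)).fromBlocks rfl
    ((hRblock.add hSblock).fromBlocks rfl ((hRblock.add hSblock).add hT))

theorem dotProduct_Psi_mulVec (hS : ∀ c, (S c).IsHermitian) (x₁ : Fin n → ℝ)
    (x₂ : Fin (n - 1) → ℝ) (x₃ x₄ : Fin (n - 1) × C → ℝ) :
    Sum.elim (Sum.elim x₁ x₂) (Sum.elim x₃ x₄) ⬝ᵥ
        Psi D A K W G ch h R S S12 *ᵥ Sum.elim (Sum.elim x₁ x₂) (Sum.elim x₃ x₄) =
      x₁ ⬝ᵥ (D * x₁) + x₂ ⬝ᵥ reduced K A W (laplacian G) *ᵥ x₂ +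
        Sum.elim x₃ x₄ ⬝ᵥ couplingMatrix R S12 *ᵥ Sum.elim x₃ x₄ +
        (x₃ + x₄) ⬝ᵥ blockDiagonal S *ᵥ (x₃ + x₄) +
        psiRemainder (sqrtGain K * W) (reduced K A W (laplacian G)) (∑ c, h c ^ 2 • R c)
          (fun c => reduced K A W (channelMatrix G ch c)) S x₁ x₂ x₃ x₄ := by
  have hsymm : x₄ ⬝ᵥ blockDiagonal S *ᵥ x₃ = x₃ ⬝ᵥ blockDiagonal S *ᵥ x₄ := by
    rw [dotProduct_comm, dotProduct_mulVec, ← mulVec_transpose,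
      (isHermitian_iff_isSymm.1 (Matrix.isHermitian_blockDiagonal_iff.2 hS)).eq]
  have hD : diagonal D *ᵥ x₁ = D * x₁ := funext (mulVec_diagonal D x₁)
  unfold Psi couplingMatrix psiRemainder
  rw [dotProduct_fromBlocks_mulVec, dotProduct_fromBlocks_mulVec, dotProduct_fromBlocks_mulVec,
    dotProduct_fromBlocks_mulVec, Matrix.fromBlocks_mulVec, sumElim_dotProduct_sumElim]
  simp only [Sum.elim_comp_inl, Sum.elim_comp_inr, zero_mulVec, zero_add, dotProduct_add,
    add_mulVec, sub_mulVec, neg_mulVec, dotProduct_sub, dotProduct_neg, mulVec_add, add_dotProduct,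
    hsymm, hD]
  ring

theorem posDef_Psi {s b ν : ℝ} (hs : 0 < s) (hs₁ : s ≤ 1) (hD : ∀ i, ν ≤ D i)
    (hcoercive : ∀ x, ν * (s * ‖x‖₂) ^ 2 ≤ x ⬝ᵥ reduced K A W (laplacian G) *ᵥ x)
    (hcoupling : ∀ y, ν * ‖y‖₂ ^ 2 ≤ y ⬝ᵥ couplingMatrix R S12 *ᵥ y)
    (hR : ∀ c, (R c).IsHermitian) (hS : ∀ c, (S c).PosSemidef)
    (hB : ‖sqrtGain K * W‖ ≤ s * b) (hL : ‖reduced K A W (laplacian G)‖ ≤ s ^ 2 * b)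
    (hRbar : ‖∑ c, h c ^ 2 • R c‖ ≤ b)
    (hT : ∀ c, ‖reduced K A W (channelMatrix G ch c)‖ ≤ s ^ 2 * b) (hSnorm : ∀ c, ‖S c‖ ≤ s ^ 2)
    (hsmall : s * (11 * ((Fintype.card C + 1) * (b ^ 3 + b + 1))) < ν) :
    (Psi D A K W G ch h R S S12).PosDef := by
  refine PosDef.of_dotProduct_mulVec_pos (isHermitian_Psi hR fun c => (hS c).isHermitian)
    fun x hx => ?_
  obtain ⟨x₁, x₂, x₃, x₄, rfl⟩ : ∃ x₁ x₂ x₃ x₄,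
      x = Sum.elim (Sum.elim x₁ x₂) (Sum.elim x₃ x₄) :=
    ⟨(x ∘ Sum.inl) ∘ Sum.inl, (x ∘ Sum.inl) ∘ Sum.inr, (x ∘ Sum.inr) ∘ Sum.inl,
      (x ∘ Sum.inr) ∘ Sum.inr, by simp only [Sum.elim_comp_inl_inr]⟩
  obtain ⟨Q, hQ⟩ : ∃ Q, Q = ‖x₁‖₂ ^ 2 + (s * ‖x₂‖₂) ^ 2 + ‖x₃‖₂ ^ 2 + ‖x₄‖₂ ^ 2 := ⟨_, rfl⟩
  have hQpos : 0 < Q := by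
    have hnorm := pow_pos (l2Norm_pos hx) 2
    simp only [l2Norm_sumElim_sq] at hnorm
    have hle : s ^ 2 * (‖x₁‖₂ ^ 2 + ‖x₂‖₂ ^ 2 + (‖x₃‖₂ ^ 2 + ‖x₄‖₂ ^ 2)) ≤ Q := by
      nlinarith [pow_le_one₀ hs.le hs₁ (n := 2), sq_nonneg ‖x₁‖₂, sq_nonneg ‖x₃‖₂, sq_nonneg ‖x₄‖₂]
    exact (by positivity : 0 < s ^ 2 * _).trans_le hle
  have hremainder := neg_le_of_abs_le (abs_psiRemainder_le hs.le hs₁ hB hL hRbar hT hSnorm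
    (x₁ := x₁) (x₂ := x₂) (x₃ := x₃) (x₄ := x₄) (Q := Q) (by nlinarith) (by nlinarith)
    (by nlinarith) (by nlinarith))
  have hsecond := dotProduct_blockDiagonal_mulVec_nonneg hS (x₃ + x₄)
  have hfirst := mul_l2Norm_sq_le_dotProduct_mul hD x₁
  have hchannel := hcoupling (Sum.elim x₃ x₄)
  rw [l2Norm_sumElim_sq] at hchannel
  have hdominated := mul_lt_mul_of_pos_right hsmall hQpos
  rw [star_trivial, dotProduct_Psi_mulVec fun c => (hS c).isHermitian]
  rw [hQ] at hdominated hremainder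
  linarith [hcoercive x₂]

theorem eventually_exists_solvesLMI {ι : Type*} [Finite ι] {G : ι → SimpleGraph (Fin n)}
    (hG : ∀ ℓ, (G ℓ).Connected) (ch : ι → Fin n → Fin n → C) (hA : ∀ i, 0 < A i)
    (hD : ∀ i, 0 < D i) (hK : ∀ i, 0 < K i) (h : C → ℝ) (hRS : (couplingMatrix R S12).PosDef) :
    ∀ᶠ κ in 𝓝[>] (0 : ℝ), ∀ W, IsReduction (κ • K) A W →
      ∃ S, SolvesLMI D A (κ • K) W G ch h R S S12 := by
  obtain ⟨d, hd, hdamping⟩ := exists_pos_forall_le hD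
  obtain ⟨lam, hlam, hcoercive⟩ := exists_reduced_laplacian_coercive hG hK hA
  obtain ⟨c₀, hc₀, hcoupling⟩ := exists_pos_mul_l2Norm_sq_le_of_posDef hRS
  obtain ⟨bL, hbL⟩ := exists_norm_reduced_le K A fun ℓ => laplacian (G ℓ)
  obtain ⟨bT, hbT⟩ := exists_norm_reduced_le K A fun j : ι × C =>
    channelMatrix (G j.1) (ch j.1) j.2
  obtain ⟨b, hB, hR, hL, hT⟩ : ∃ b, ‖sqrtGain K‖ ≤ b ∧ ‖∑ c, h c ^ 2 • R c‖ ≤ b ∧ bL ≤ b ∧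
      bT ≤ b :=
    ⟨max (max ‖sqrtGain K‖ ‖∑ c, h c ^ 2 • R c‖) (max bL bT), by simp⟩
  obtain ⟨ν, hν, hνd, hνlam, hνc⟩ : ∃ ν > 0, ν ≤ d ∧ ν ≤ lam ∧ ν ≤ c₀ :=
    ⟨min d (min lam c₀), by positivity, by simp⟩
  filter_upwards [self_mem_nhdsWithin,
    tendsto_sqrt_nhdsGT_zero.eventually (eventually_mul_le 1 one_pos),
    tendsto_sqrt_nhdsGT_zero.eventually
      (eventually_mul_le (11 * ((Fintype.card C + 1) * (b ^ 3 + b + 1))) (half_pos hν))]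
    with κ (hκ : 0 < κ) hκ₁ hκν W hW
  have hW₁ := hW.of_smul hκ
  have hκsq := Real.sq_sqrt hκ.le
  have hreduced {X : Matrix (Fin n) (Fin n) ℝ} (hX : ‖reduced K A W X‖ ≤ b) :
      ‖reduced (κ • K) A W X‖ ≤ √κ ^ 2 * b := by
    rw [reduced_smul hκ.le, norm_smul, Real.norm_of_nonneg hκ.le, hκsq]
    gcongr
  have hSpos : (κ • (1 : Matrix (Fin (n - 1)) (Fin (n - 1)) ℝ)).PosDef := PosDef.one.smul hκ
  have hRpos := posDef_of_couplingMatrix_posDef hRS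
  refine ⟨fun _ => κ • 1, hRpos, fun _ => hSpos, fun ℓ => ?_, hRS.posSemidef⟩
  refine posDef_Psi (s := √κ) (b := b) (Real.sqrt_pos.2 hκ) (by linarith)
    (fun i => hνd.trans (hdamping i)) (fun x => ?_)
    (fun y => (by gcongr : ν * ‖y‖₂ ^ 2 ≤ c₀ * ‖y‖₂ ^ 2).trans (hcoupling y))
    (fun c => (hRpos c).isHermitian) (fun _ => hSpos.posSemidef)
    ((hW.norm_sqrtGain_smul_mul_le hκ).trans (by gcongr))
    (hreduced ((hbL W hW₁ ℓ).trans hL)) hR (fun c => hreduced ((hbT W hW₁ (ℓ, c)).trans hT))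
    (fun _ => ?_) (hκν.trans_lt (half_lt_self hν))
  · rw [reduced_smul hκ.le, smul_mulVec, dotProduct_smul, smul_eq_mul, mul_pow, hκsq]
    nlinarith [hcoercive W hW₁ ℓ x, mul_le_mul_of_nonneg_right hνlam (sq_nonneg ‖x‖₂)]
  · rw [norm_smul, Real.norm_of_nonneg hκ.le, hκsq]
    exact mul_le_of_le_one_right hκ.le norm_one_le_one

end SmallGain

section ReducedErrorSystem

variable {n : ℕ} {ι C : Type*} [Fintype C] {G : ι → SimpleGraph (Fin n)} {A D K : Fin n → ℝ}
  {W : Matrix (Fin n) (Fin (n - 1)) ℝ} {h : ℝ}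

theorem mu_pos [Nonempty (Fin n)] (hK : ∀ i, 0 < K i) (hA : ∀ i, 0 < A i) : 0 < mu K A :=
  Finset.sum_pos (fun i _ => mul_self_pos.2
    (mul_pos (inv_pos.2 (Real.sqrt_pos.2 (hK i))) (inv_pos.2 (hA i))).ne') Finset.univ_nonempty

theorem errorField_uniform (N : PowerNetwork n) (D A K : Fin n → ℝ)
    (W : Matrix (Fin n) (Fin (n - 1)) ℝ) (θs : Fin n → ℝ) (G : SimpleGraph (Fin n))
    (ch : Fin n → Fin n → C) (z : State n) (q : Fin (n - 1) → ℝ) :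
    errorField N D A K W θs G ch z (fun _ => q) =
      delayField N.M D (sqrtGain K * W) (N.errorGrad θs A⁻¹ (mu K A)⁻¹)
        (reduced K A W (laplacian G)) z q := by
  classical
  have htranspose : (sqrtGain K * W)ᵀ = Wᵀ * sqrtGain K := by
    rw [transpose_mul, sqrtGain, diagonal_transpose]
  refine Prod.ext rfl (Prod.ext (funext fun i => ?_) ?_)
  · simp only [errorField, delayField, PowerNetwork.errorGrad, Pi.add_apply, Pi.sub_apply,
      Pi.smul_apply, Pi.mul_apply, Pi.inv_apply, Pi.neg_apply, smul_eq_mul, dotProduct]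
    ring
  · simp only [errorField, delayField, htranspose, ← sum_channelMatrix G ch, ← reduced_sum,
      sum_mulVec]

theorem isSolution_uniform (N : PowerNetwork n) (θs : Fin n → ℝ)
    (ch : ι → Fin n → Fin n → C) :
    (fun j : Signal ι h => IsSolution N D A K W θs G ch h j.σ fun _ => j.τ) =
      IsDelaySolution (fun ℓ z y => delayField N.M D (sqrtGain K * W)
        (N.errorGrad θs A⁻¹ (mu K A)⁻¹) (reduced K A W (laplacian (G ℓ))) z y.2.2) h := by
  have hfield : (fun ℓ z (y : State n) => delayField N.M D (sqrtGain K * W)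
      (N.errorGrad θs A⁻¹ (mu K A)⁻¹) (reduced K A W (laplacian (G ℓ))) z y.2.2) =
        fun ℓ z y => errorField N D A K W θs (G ℓ) (ch ℓ) z fun _ => y.2.2 :=
    funext₃ fun _ _ _ => (errorField_uniform ..).symm
  rw [hfield]
  rfl

theorem isLUES_isSolution [Finite ι] [Nonempty (Fin n)] (ch : ι → Fin n → Fin n → C)
    {d l lam γ : ℝ} (hA : ∀ i, 0 < A i) (hK : ∀ i, 0 < K i)
    (hB : GainBounds D (sqrtGain K * W) (fun ℓ => reduced K A W (laplacian (G ℓ))) h d l lam γ)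
    (N : PowerNetwork n) {θs : Fin n → ℝ}
    (hθs : ∀ i k, N.B i k ≠ 0 → |θs i - θs k| < Real.pi / 2) :
    IsLUES h fun j : Signal ι h => IsSolution N D A K W θs G ch h j.σ fun _ => j.τ := by
  obtain ⟨r, c, C, hP⟩ := N.exists_localPotential (a := A⁻¹) (inv_pos.2 (mu_pos hK hA))
    (fun i => inv_pos.2 (hA i)) hθs
  rw [isSolution_uniform]
  exact hP.isLUES_delayField hB N.M_pos (N.continuous_errorGrad _ _ _) (N.errorGrad_zero _ _ _)

end ReducedErrorSystem

end DAI

theorem corollary1_general {n : ℕ}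
    {ι : Type*} [Finite ι] (G : ι → SimpleGraph (Fin n)) (hG : ∀ ℓ, (G ℓ).Connected)
    {C : Type*} [Fintype C] [DecidableEq C] (ch : ι → Fin n → Fin n → C)
    (A D Kc : Fin n → ℝ) (hA : ∀ i, 0 < A i) (hD : ∀ i, 0 < D i) (hKc : ∀ i, 0 < Kc i)
    (h : ℝ) (hh : 0 ≤ h)
    (R S12 : C → Matrix (Fin (n - 1)) (Fin (n - 1)) ℝ)
    (hRS : (DAI.couplingMatrix R S12).PosDef) :
    ∃ κ₀ > 0, ∀ κ : ℝ, 0 < κ → κ < κ₀ →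
      ∀ W : Matrix (Fin n) (Fin (n - 1)) ℝ, DAI.IsReduction (κ • Kc) A W →
        (∃ S, DAI.SolvesLMI D A (κ • Kc) W G ch (fun _ => h) R S S12) ∧
        ∀ (N : DAI.PowerNetwork n) (θs : Fin n → ℝ),
          (∀ i k, N.B i k ≠ 0 → |θs i - θs k| < Real.pi / 2) →
          DAI.IsLUES h fun (j : DAI.Signal ι h) =>
            DAI.IsSolution N D A (κ • Kc) W θs G ch h j.σ (fun _ => j.τ) := by
  obtain ⟨κ₀, hκ₀, hsmall⟩ := mem_nhdsGT_iff_exists_Ioo_subset.1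
    ((DAI.eventually_exists_solvesLMI hG ch hA hD hKc (fun _ => h) hRS).and
      (DAI.eventually_exists_gainBounds hG hA hD hKc hh))
  refine ⟨κ₀, hκ₀, fun κ hκ hκκ₀ W hW => ?_⟩
  obtain ⟨hlmi, hgain⟩ := hsmall ⟨hκ, hκκ₀⟩
  obtain ⟨d, l, lam, γ, hB⟩ := hgain W hW
  refine ⟨hlmi W hW, fun N θs hθs => ?_⟩
  have := N.connected.nonempty
  exact DAI.isLUES_isSolution ch hA (fun i => mul_pos hκ (hKc i)) hB N hθs

theorem corollary1 {n : ℕ} (hn : 1 ≤ n)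
    {ι : Type*} [Finite ι] (G : ι → SimpleGraph (Fin n)) (hG : ∀ ℓ, (G ℓ).Connected)
    {C : Type*} [Fintype C] [DecidableEq C] (ch : ι → Fin n → Fin n → C)
    (A D Kc : Fin n → ℝ) (hA : ∀ i, 0 < A i) (hD : ∀ i, 0 < D i) (hKc : ∀ i, 0 < Kc i)
    (h : ℝ) (hh : 0 ≤ h)
    (R S12 : C → Matrix (Fin (n - 1)) (Fin (n - 1)) ℝ)
    (hRS : (DAI.couplingMatrix R S12).PosDef) :
    ∃ κ₀ > 0, ∀ κ : ℝ, 0 < κ → κ < κ₀ →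
      ∀ W : Matrix (Fin n) (Fin (n - 1)) ℝ, DAI.IsReduction (κ • Kc) A W →
        (∃ S, DAI.SolvesLMI D A (κ • Kc) W G ch (fun _ => h) R S S12) ∧
        ∀ (N : DAI.PowerNetwork n) (θs : Fin n → ℝ) (ωs : ℝ) (ps : Fin n → ℝ),
          DAI.IsSynchronizedMotion N D A (κ • Kc) G ch θs ωs ps →
          DAI.IsLUAS h fun (j : DAI.Signal ι h) =>
            DAI.IsSolution N D A (κ • Kc) W θs G ch h j.σ (fun _ => j.τ) := by
  obtain ⟨κ₀, hκ₀, hsmall⟩ := corollary1_general G hG ch A D Kc hA hD hKc h hh R S12 hRS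
  exact ⟨κ₀, hκ₀, fun κ hκ hκκ₀ W hW => ⟨(hsmall κ hκ hκκ₀ W hW).1, fun N θs _ _ hsync =>
    ((hsmall κ hκ hκκ₀ W hW).2 N θs hsync.angles).isLUAS⟩⟩
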